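/- Let $K$ be a field, $R=K[x_1,\dots,x_n]$ with $x_1<\dots<x_n$, and let $\mathbb T$ be the set of terms (power products) of $R$; for a term $\tau\neq 1$ let $\min(\tau)$ be the smallest variable dividing $\tau$. Let $\mathcal O\subset\mathbb T$ be a finite order ideal (a finite set of terms closed under taking divisors), let $\partial\mathcal O=\{x_i\tau\mid \tau\in\mathcal O,\ 1\le i\le n\}\setminus\mathcal O$ be its border, and let $\mathcal P_{\mathcal O}$ be the Pommaret basis of the ideal generated by $\mathbb T\setminus\mathcal O$, i.e. the set of terms $\sigma\notin\mathcal O$ with $\sigma/\min(\sigma)\in\mathcal O$ (with the convention that $1$ belongs to it if $1\notin\mathcal O$). Let $C=\{C_{\tau\sigma}\mid\tau\in\partial\mathcal O,\ \sigma\in\mathcal O\}$ be parameters, let $\tilde C\subseteq C$ be the set of those $C_{\tau\sigma}$ with $\tau\notin\mathcal P_{\mathcal O}$, and put $g_\tau=\tau-\sum_{\sigma\in\mathcal O}C_{\tau\sigma}\sigma$ (with head term $\tau$), $\mathscr B=\{g_\tau\mid\tau\in\partial\mathcal O\}$, $\mathscr P=\{g_\tau\mid\tau\in\partial\mathcal O\cap\mathcal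 P_{\mathcal O}\}$. (If $\mathcal O\ne\emptyset$ then $\mathcal P_{\mathcal O}\subseteq\partial\mathcal O$; if $\mathcal O=\emptyset$ then $C=\emptyset$, $\mathscr P$ is to be read as $\{1\}$, and $\mathfrak B=\mathfrak P=0$ below.) The terms of the border are labelled $\beta_1,\dots,\beta_m$ with non-decreasing degree (in any order within one degree). A term $\mu$ is called multiplicative for $\beta_i$, with respect to $\mathscr B$, if no $\beta_j$ with $j>i$ divides $\beta_i\mu$; it is called multiplicative for $\alpha\in\mathcal P_{\mathcal O}$, with respect to $\mathscr P$, if every variable dividing $\mu$ is $\le\min(\alpha)$ (no condition if $\alpha=1$). A reduction step with respect to $\mathscr B$ (resp. $\mathscr P$) replaces a polynomial $g$ by $g-c\,\eta\, g_\alpha$, where $\eta$ is multiplicative for the head term $\alpha$ and $c\neq0$ is the coefficient of the term $\eta\alpha$ in $g$; $g$ reduces to $h$ if $h$ is obtained from $g$ by finitely many (possibly zero) steps. A polynomial is $\mathcal O$-reduced if its support is contained in $\mathcal O$. The $S$-polynomial of $g_\alpha,g_{\alpha'}$ is $\eta g_\alpha-\eta'g_{\alpha'}$, where $\eta\alpha=\eta'\alpha'=\mathrm{lcm}(\alpha,\alpha')$.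 Let $\mathfrak B\subset K[C]$ be the ideal generated by the coefficients (in $K[C]$, of the terms in $x_1,\dots,x_n$) of the $\mathcal O$-reduced polynomials to which the $S$-polynomials of pairs $g_\alpha,g_{\alpha'}\in\mathscr B$ with $\alpha=x_j\alpha'$ for some $j$, or $x_i\alpha=x_j\alpha'$ for some $i,j$, reduce with respect to $\mathscr B$. Let $\mathfrak P\subset K[C\setminus\tilde C]$ be the ideal generated by the coefficients of the $\mathcal O$-reduced polynomials to which the $S$-polynomials of pairs $g_\alpha,g_{\alpha'}\in\mathscr P$, such that for some $x_i$ not multiplicative for $\alpha$ one has $x_i\alpha=\delta\alpha'$ with $\delta$ multiplicative for $\alpha'$, reduce with respect to $\mathscr P$. The border marked scheme is $\operatorname{Spec}(K[C]/\mathfrak B)\subseteq\mathbb A^{|C|}=\operatorname{Spec}K[C]$, and the Pommaret marked scheme is $\operatorname{Spec}(K[C\setminus\tilde C]/\mathfrak P)\subseteq\mathbb A^{|C\setminus\tilde C|}=\operatorname{Spec}K[C\setminus\tilde C]$. **Corollary.** The coordinate projection $\mathbb A^{|C|}\to\mathbb A^{|C\setminus\tilde C|}$ (dual to the inclusion $K[C\setminus\tilde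 C]\subseteq K[C]$) restricts to an isomorphism from the border marked scheme onto the Pommaret marked scheme. In particular, the restriction of this projection to the border marked scheme is a closed embedding of it in the affine space $\mathbb A^{|C\setminus\tilde C|}$, whose dimension is $|C\setminus\tilde C|=|C|-|\tilde C|$. -/

import Mathlib

open CategoryTheory AlgebraicGeometry MvPolynomial

noncomputable section

namespace BorderPommaret

/-! Terms in `x_1 < ... < x_n` are exponent vectors, so `≤` is divisibility, `+` is the product,
`⊔` is the lcm and an order ideal is a lower set. -/

/-- The set `𝕋` of terms in `n` variables. -/
abbrev Term (n : ℕ) : Type := Fin n →₀ ℕ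

/-- The term `x_i`. -/
abbrev var {n : ℕ} (i : Fin n) : Term n := Finsupp.single i 1

/-- `min(τ)`: the smallest variable dividing the term `τ ≠ 1`. -/
def minVar {n : ℕ} (τ : Term n) (h : τ ≠ 0) : Fin n :=
  τ.support.min' (Finsupp.support_nonempty_iff.mpr h)

/-- The border `∂O = {x_i τ | τ ∈ O} \ O`. -/
def border {n : ℕ} (O : Finset (Term n)) : Finset (Term n) :=
  ((Finset.univ : Finset (Fin n)) ×ˢ O).image (fun p => var p.1 + p.2) \ O

/-- The Pommaret basis `P_O` of the monomial ideal `J` with `J ∩ 𝕋 = 𝕋 \ O`: the terms `σ ∈ J`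
with `σ / min(σ) ∉ J`. (The term `1`, for which `min` is undefined, belongs to it if and only if
`J` is the unit ideal, that is, `O` is empty.) -/
def pommaretBasis {n : ℕ} (O : Finset (Term n)) : Set (Term n) :=
  {σ | σ ∉ O ∧ ∀ h : σ ≠ 0, σ - var (minVar σ h) ∈ O}

/-- The cone `{η α | η ∈ M}` of the term `α` by the set of terms `M`. -/
def cone {n : ℕ} (M : Set (Term n)) (α : Term n) : Set (Term n) :=
  {γ | ∃ η ∈ M, γ = η + α}

/-- Reduction structures. -/
structure ReductionStructure (n : ℕ) where
  /-- the head terms -/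
  head : Set (Term n)
  /-- the tail sets -/
  tail : head → Finset (Term n)
  /-- the multiplicative sets -/
  mult : head → Set (Term n)
  head_finite : head.Finite
  mult_isLowerSet : ∀ α, IsLowerSet (mult α)
  /-- the cones cover the terms of the ideal generated by the head terms -/
  iUnion_cone : ⋃ α : head, cone (mult α) α = {γ | ∃ α ∈ head, α ≤ γ}
  tail_disjoint : ∀ α : head, ∀ σ ∈ tail α, σ ∉ cone (mult α) α

section Reduction

variable {n : ℕ} {A : Type*} [CommRing A]

/-- One reduction step `g → h` for the marked set `F = (f_α)`, with `Ht(f_α) = α`: there is a term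
`γ = η α` in the support of `g` with `η` multiplicative for `α`, and `h = g - c η f_α`, where `c`
is the coefficient of `γ` in `g`. -/
def ReductionStructure.Step (R : ReductionStructure n) (F : R.head → MvPolynomial (Fin n) A)
    (g h : MvPolynomial (Fin n) A) : Prop :=
  ∃ (α : R.head) (η : Term n), η ∈ R.mult α ∧ coeff (η + (α : Term n)) g ≠ 0 ∧
    h = g - monomial η (coeff (η + (α : Term n)) g) * F α

/-- The reduction relation: `h` is reached from `g` by finitely many (possibly no) steps. -/
def ReductionStructure.Reduces (R : ReductionStructure n) (F : R.head → MvPolynomial (Fin n) A) :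
    MvPolynomial (Fin n) A → MvPolynomial (Fin n) A → Prop :=
  Relation.ReflTransGen (R.Step F)

/-- `h` is `O`-reduced: its support is contained in `O`. -/
def IsReduced (O : Finset (Term n)) (h : MvPolynomial (Fin n) A) : Prop :=
  h.support ⊆ O

/-- The `S`-polynomial `η f - η' f'` of marked polynomials `f`, `f'` with head terms `α`, `α'`,
where `η α = η' α' = lcm(α, α')`. -/
def sPoly (α α' : Term n) (f f' : MvPolynomial (Fin n) A) : MvPolynomial (Fin n) A :=
  monomial (α ⊔ α' - α) 1 * f - monomial (α ⊔ α' - α') 1 * f'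

end Reduction

/-- `(α, α')` is a neighbour couple: `α = x_j α'` or `x_i α = x_j α'`. -/
def IsNeighbourCouple {n : ℕ} (α α' : Term n) : Prop :=
  (∃ j, α = var j + α') ∨ ∃ i j, var i + α = var j + α'

/-- `(α, α')` is a non-multiplicative couple: some variable `x_i` that is not multiplicative for
`α` has `x_i α` in the cone of `α'`. -/
def ReductionStructure.IsNonMultCouple {n : ℕ} (R : ReductionStructure n) (α α' : R.head) : Prop :=
  ∃ i, var i ∉ R.mult α ∧ var i + (α : Term n) ∈ cone (R.mult α') α'

section Structures

variable {n : ℕ}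

/-- The border reduction structure, for the labelling `β` of the terms of the border:
`μ` is multiplicative for `β_i` if no `β_j` with `j > i` divides `β_i μ`. -/
def borderRS (O : Finset (Term n)) (hO : IsLowerSet (O : Set (Term n)))
    (β : Fin (border O).card ≃ border O) : ReductionStructure n where
  head := {τ | τ ∈ border O}
  tail _ := O
  mult b := {μ | ∀ j, β.symm b < j → ¬ (β j : Term n) ≤ b + μ}
  head_finite := (border O).finite_toSet
  mult_isLowerSet := by
    intro b μ ν hνμ hμ j hj hle
    exact hμ j hj (hle.trans (by gcongr))
  iUnion_cone := by
    classical
    ext γ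
    simp only [Set.mem_iUnion, cone, Set.mem_ofPred_eq]
    constructor
    · rintro ⟨b, μ, -, rfl⟩
      exact ⟨b, b.2, le_add_of_nonneg_left zero_le⟩
    · rintro ⟨b, hb, hbγ⟩
      obtain ⟨i, hi, hmax⟩ := (Finset.univ.filter
        (fun i => (β i : Term n) ≤ γ)).exists_max_image id ⟨β.symm ⟨b, hb⟩, by simpa using hbγ⟩
      simp only [Finset.mem_filter, Finset.mem_univ, true_and, id] at hi hmax
      refine ⟨⟨β i, (β i).2⟩, γ - β i, ?_, (tsub_add_cancel_of_le hi).symm⟩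
      intro j hj hle
      rw [add_tsub_cancel_of_le hi] at hle
      have h1 := hmax j hle
      have h2 : i < j := by simpa using hj
      exact absurd h1 (not_le.mpr h2)
  tail_disjoint := by
    rintro ⟨b, hb⟩ σ hσ ⟨μ, -, rfl⟩
    have hb' : b ∉ O := (Finset.mem_sdiff.mp hb).2
    exact hb' (hO (le_add_of_nonneg_left zero_le) hσ)

theorem minVar_mem {σ : Term n} (h : σ ≠ 0) : minVar σ h ∈ σ.support :=
  Finset.min'_mem _ _

theorem minVar_le {σ : Term n} (h : σ ≠ 0) {i : Fin n} (hi : i ∈ σ.support) : minVar σ h ≤ i :=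
  Finset.min'_le _ _ hi

theorem var_minVar_le {σ : Term n} (h : σ ≠ 0) : var (minVar σ h) ≤ σ := by
  rw [Finsupp.single_le_iff]
  exact Nat.one_le_iff_ne_zero.mpr (Finsupp.mem_support_iff.mp (minVar_mem h))

/-- If `O` is not empty, then the Pommaret basis is contained in the border. -/
theorem pommaretBasis_subset_border {O : Finset (Term n)} (hO : IsLowerSet (O : Set (Term n)))
    (hne : O.Nonempty) {τ : Term n} (hτ : τ ∈ pommaretBasis O) : τ ∈ border O := by
  have h0 : τ ≠ 0 := by
    rintro rfl
    obtain ⟨σ, hσ⟩ := hne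
    exact hτ.1 (hO zero_le hσ)
  refine Finset.mem_sdiff.mpr ⟨Finset.mem_image.mpr ⟨(minVar τ h0, τ - var (minVar τ h0)), ?_, ?_⟩,
    hτ.1⟩
  · exact Finset.mem_product.mpr ⟨Finset.mem_univ _, hτ.2 h0⟩
  · exact add_tsub_cancel_of_le (var_minVar_le h0)

theorem pommaretBasis_finite {O : Finset (Term n)} (hO : IsLowerSet (O : Set (Term n))) :
    (pommaretBasis O).Finite := by
  classical
  refine (insert 0 (border O)).finite_toSet.subset fun τ hτ => ?_
  rcases O.eq_empty_or_nonempty with rfl | hne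
  · by_cases h : τ = 0
    · simp [h]
    · exact absurd (hτ.2 h) (by simp)
  · exact Finset.mem_coe.mpr
      (Finset.mem_insert_of_mem (pommaretBasis_subset_border hO hne hτ))

/-- Every term outside `O` lies in the cone of some `α ∈ P_O` by `𝕋 ∩ K[x_1, ..., min(α)]`. -/
theorem exists_pommaret_cone (O : Finset (Term n)) (γ : Term n) (hγ : γ ∉ O) :
    ∃ α ∈ pommaretBasis O,
      γ ∈ cone {μ | ∀ h : α ≠ 0, ∀ i ∈ μ.support, i ≤ minVar α h} α := by
  induction hd : γ.degree using Nat.strong_induction_on generalizing γ with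
  | _ d ih =>
    subst hd
    by_cases hP : γ ∈ pommaretBasis O
    · exact ⟨γ, hP, 0, by simp, by simp⟩
    · have h : ∃ h : γ ≠ 0, γ - var (minVar γ h) ∉ O := by
        by_contra hcon
        push Not at hcon
        exact hP ⟨hγ, hcon⟩
      obtain ⟨h0, hO'⟩ := h
      have hadd : γ - var (minVar γ h0) + var (minVar γ h0) = γ :=
        tsub_add_cancel_of_le (var_minVar_le h0)
      have hlt : (γ - var (minVar γ h0)).degree < γ.degree := by
        conv_rhs => rw [← hadd]
        simp
      obtain ⟨α, hα, μ, hμ, hsub⟩ := ih _ hlt _ hO' rfl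
      refine ⟨α, hα, μ + var (minVar γ h0), ?_, ?_⟩
      · intro hα0 i hi
        rcases Finset.mem_union.mp (Finsupp.support_add hi) with hi | hi
        · exact hμ hα0 i hi
        · obtain rfl : i = minVar γ h0 := by
            simpa using Finsupp.support_single_subset hi
          apply minVar_le
          have h1 := Finsupp.mem_support_iff.mp (minVar_mem hα0)
          rw [Finsupp.mem_support_iff, ← hadd, hsub]
          simp only [Finsupp.add_apply]
          omega
      · calc γ = μ + α + var (minVar γ h0) := by rw [← hsub, hadd]
          _ = μ + var (minVar γ h0) + α := by abel

/-- The Pommaret reduction structure: `μ` is multiplicative for `α ∈ P_O` if it is a term in the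
variables `x_1, ..., min(α)`. -/
def pommaretRS (O : Finset (Term n)) (hO : IsLowerSet (O : Set (Term n))) :
    ReductionStructure n where
  head := pommaretBasis O
  tail _ := O
  mult α := {μ | ∀ h : (α : Term n) ≠ 0, ∀ i ∈ μ.support, i ≤ minVar α h}
  head_finite := pommaretBasis_finite hO
  mult_isLowerSet := by
    intro α μ ν hνμ hμ h i hi
    exact hμ h i (Finsupp.support_mono hνμ hi)
  iUnion_cone := by
    ext γ
    simp only [Set.mem_iUnion]
    constructor
    · rintro ⟨α, μ, -, rfl⟩
      exact ⟨α, α.2, le_add_of_nonneg_left zero_le⟩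
    · rintro ⟨α, hα, hle⟩
      obtain ⟨α', hα', h⟩ := exists_pommaret_cone O γ (fun hγ => hα.1 (hO hle hγ))
      exact ⟨⟨α', hα'⟩, h⟩
  tail_disjoint := by
    rintro ⟨α, hα⟩ σ hσ ⟨μ, -, rfl⟩
    exact hα.1 (hO (le_add_of_nonneg_left zero_le) hσ)

/-- The set of parameters `C = {C_{τσ} | τ ∈ ∂O, σ ∈ O}`. -/
abbrev Param (O : Finset (Term n)) : Type := border O × O

/-- The set `C̃` of parameters in the generic marked polynomials with head term in `∂O \ P_O`. -/
def Ctilde (O : Finset (Term n)) : Set (Param O) :=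
  {c | (c.1 : Term n) ∉ pommaretBasis O}

/-- The parameter `C_{τσ}`, for `τ ∈ P_O` and `σ ∈ O`, as an element of `C \ C̃`. -/
def pommaretParam (O : Finset (Term n)) (hO : IsLowerSet (O : Set (Term n)))
    (τ : pommaretBasis O) (σ : O) : ↥(Ctilde O)ᶜ :=
  ⟨(⟨τ, pommaretBasis_subset_border hO ⟨σ, σ.2⟩ τ.2⟩, σ), fun h => h τ.2⟩

end Structures

section Schemes

variable {n : ℕ} (K : Type*) [Field K]

/-- The generic marked polynomial `τ - ∑_{σ ∈ O} C_{τσ} σ` with head term `τ`, over `K[C]`. -/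
def genericMarked {ι : Type} (O : Finset (Term n)) (τ : Term n) (C : O → ι) :
    MvPolynomial (Fin n) (MvPolynomial ι K) :=
  monomial τ 1 - ∑ σ : O, monomial (σ : Term n) (X (C σ))

variable (O : Finset (Term n)) (hO : IsLowerSet (O : Set (Term n)))

/-- The generic `∂O`-marked set. -/
def genericBorderSet (β : Fin (border O).card ≃ border O) (τ : (borderRS O hO β).head) :
    MvPolynomial (Fin n) (MvPolynomial (Param O) K) :=
  genericMarked K O τ (fun σ => (⟨τ, τ.2⟩, σ))

/-- The generic `P_O`-marked set. -/
def genericPommaretSet (τ : (pommaretRS O hO).head) :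
    MvPolynomial (Fin n) (MvPolynomial ↥(Ctilde O)ᶜ K) :=
  genericMarked K O τ (pommaretParam O hO τ)

/-- The ideal `𝔅 ⊆ K[C]` generated by the coefficients of the `O`-reduced polynomials to which the
`S`-polynomials of the neighbour couples of the generic `∂O`-marked set reduce. -/
def borderIdeal (β : Fin (border O).card ≃ border O) : Ideal (MvPolynomial (Param O) K) :=
  Ideal.span {c | ∃ r s : (borderRS O hO β).head, IsNeighbourCouple (r : Term n) s ∧
    ∃ h, IsReduced O h ∧
      (borderRS O hO β).Reduces (genericBorderSet K O hO β)
        (sPoly r s (genericBorderSet K O hO β r) (genericBorderSet K O hO β s)) h ∧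
      ∃ σ, c = coeff σ h}

/-- The ideal `𝔓 ⊆ K[C \ C̃]` generated by the coefficients of the `O`-reduced polynomials to which
the `S`-polynomials of the non-multiplicative couples of the generic `P_O`-marked set reduce. -/
def pommaretIdeal : Ideal (MvPolynomial ↥(Ctilde O)ᶜ K) :=
  Ideal.span {c | ∃ r s : (pommaretRS O hO).head, (pommaretRS O hO).IsNonMultCouple r s ∧
    ∃ h, IsReduced O h ∧
      (pommaretRS O hO).Reduces (genericPommaretSet K O hO)
        (sPoly r s (genericPommaretSet K O hO r) (genericPommaretSet K O hO s)) h ∧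
      ∃ σ, c = coeff σ h}

/-- The affine space over `K` with the elements of `ι` as coordinates. -/
abbrev affineSp (ι : Type) : Scheme :=
  Spec (CommRingCat.of (MvPolynomial ι K))

/-- The border marked scheme `Spec (K[C] / 𝔅)`. -/
abbrev borderMarkedScheme (β : Fin (border O).card ≃ border O) : Scheme :=
  Spec (CommRingCat.of (MvPolynomial (Param O) K ⧸ borderIdeal K O hO β))

/-- The Pommaret marked scheme `Spec (K[C \ C̃] / 𝔓)`. -/
abbrev pommaretMarkedScheme : Scheme :=
  Spec (CommRingCat.of (MvPolynomial ↥(Ctilde O)ᶜ K ⧸ pommaretIdeal K O hO))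

/-- The closed embedding of the border marked scheme in the affine space `𝔸^C`. -/
abbrev borderEmbedding (β : Fin (border O).card ≃ border O) :
    borderMarkedScheme K O hO β ⟶ affineSp K (Param O) :=
  Spec.map (CommRingCat.ofHom (Ideal.Quotient.mk (borderIdeal K O hO β)))

/-- The closed embedding of the Pommaret marked scheme in the affine space `𝔸^(C \ C̃)`. -/
abbrev pommaretEmbedding :
    pommaretMarkedScheme K O hO ⟶ affineSp K ↥(Ctilde O)ᶜ :=
  Spec.map (CommRingCat.ofHom (Ideal.Quotient.mk (pommaretIdeal K O hO)))

/-- The coordinate projection `𝔸^C ⟶ 𝔸^(C \ C̃)`, dual to the inclusion of `K`-algebras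
`K[C \ C̃] ⊆ K[C]`. -/
abbrev coordProjection : affineSp K (Param O) ⟶ affineSp K ↥(Ctilde O)ᶜ :=
  Spec.map (CommRingCat.ofHom
    (rename (R := K) (Subtype.val : ↥(Ctilde O)ᶜ → Param O)).toRingHom)

end Schemes

end BorderPommaret

end

open BorderPommaret

noncomputable section

namespace BorderPommaret

variable {n : ℕ} {A : Type*} [CommRing A] {A' : Type*} [CommRing A']

/-! ### Marked polynomials -/

/-! Call a specialization of the parameters good if the ideal generated by the specialized marked
set contains no nonzero `O`-reduced polynomial. An `O`-reduced polynomial reached from an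
S-polynomial stays in that ideal, so a good specialization kills its coefficients: this is
`borderIdeal_le_ker` and `pommaretIdeal_le_ker`. Conversely, for nonempty `O`, the two quotient maps
are themselves good (`eq_zero_of_mem_span_border`, `eq_zero_of_mem_span_pommaret`).

On the border side, the S-polynomial relations make the formal multiplication matrices commute
(`multOp_comm`). Evaluating polynomials at these matrices and applying the result to the basis
vector of the term 1 gives a linear map that fixes the module on `O` and kills the ideal
(`exists_borderEval`). On the Pommaret side, the relations make the module of multiplicative
multiples an ideal (`span_subset_multSpan`), and comparing multipliers in the colexicographic order
shows that this module contains no nonzero `O`-reduced polynomial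
(`eq_zero_of_isReduced_of_mem_multSpan`).

The Pommaret marked set is part of the border marked set, so the map from `K[C \ C̃]` to `K[C] / 𝔅`
kills `𝔓`. In the other direction `C_{τσ}` goes to the coefficient of `σ` in an `O`-reduced form of
`τ` modulo the Pommaret set; the border polynomials so obtained lie in the Pommaret ideal, so this
specialization is good. Goodness makes `O`-reduced forms unique, hence the two maps are mutually
inverse (`exists_algHom_of_nonempty`). -/

theorem isReduced_iff {O : Finset (Term n)} {h : MvPolynomial (Fin n) A} :
    IsReduced O h ↔ ∀ γ, γ ∉ O → coeff γ h = 0 := by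
  constructor
  · intro H γ hγ
    by_contra hne
    exact hγ (H (mem_support_iff.mpr hne))
  · intro H γ hγ
    by_contra hne
    exact mem_support_iff.mp hγ (H γ hne)

theorem IsReduced.sub {O : Finset (Term n)} {g h : MvPolynomial (Fin n) A}
    (hg : IsReduced O g) (hh : IsReduced O h) : IsReduced O (g - h) := by
  rw [isReduced_iff] at *
  intro γ hγ
  rw [coeff_sub, hg γ hγ, hh γ hγ, sub_zero]

theorem IsReduced.map {O : Finset (Term n)} {h : MvPolynomial (Fin n) A} (hh : IsReduced O h)
    (f : A →+* A') : IsReduced O (MvPolynomial.map f h) := by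
  rw [isReduced_iff] at *
  intro γ hγ
  rw [coeff_map, hh γ hγ, map_zero]

/-- The polynomial with support in `O` and coefficients `v`. -/
def ofCoeffs (O : Finset (Term n)) (v : O → A) : MvPolynomial (Fin n) A :=
  ∑ σ : O, monomial (σ : Term n) (v σ)

theorem coeff_ofCoeffs_of_mem {O : Finset (Term n)} (v : O → A) (σ : O) :
    coeff (σ : Term n) (ofCoeffs O v) = v σ := by
  classical
  rw [ofCoeffs, coeff_sum, Finset.sum_eq_single σ]
  · simp
  · intro b _ hb
    rw [coeff_monomial, if_neg]
    exact fun h => hb (Subtype.ext h)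
  · simp

theorem coeff_ofCoeffs_of_notMem {O : Finset (Term n)} (v : O → A) {γ : Term n} (hγ : γ ∉ O) :
    coeff γ (ofCoeffs O v) = 0 := by
  classical
  rw [ofCoeffs, coeff_sum]
  refine Finset.sum_eq_zero fun σ _ => ?_
  rw [coeff_monomial, if_neg]
  rintro rfl
  exact hγ σ.2

theorem isReduced_ofCoeffs (O : Finset (Term n)) (v : O → A) : IsReduced O (ofCoeffs O v) :=
  isReduced_iff.mpr fun _ => coeff_ofCoeffs_of_notMem v

theorem IsReduced.eq_ofCoeffs {O : Finset (Term n)} {h : MvPolynomial (Fin n) A}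
    (hh : IsReduced O h) : h = ofCoeffs O fun σ => coeff (σ : Term n) h := by
  ext γ
  by_cases hγ : γ ∈ O
  · exact (coeff_ofCoeffs_of_mem (fun σ : O => coeff (σ : Term n) h) ⟨γ, hγ⟩).symm
  · rw [isReduced_iff.mp hh γ hγ, coeff_ofCoeffs_of_notMem _ hγ]

/-- The marked polynomial `τ - ∑ c_σ σ`. -/
def marked (O : Finset (Term n)) (τ : Term n) (c : O → A) : MvPolynomial (Fin n) A :=
  monomial τ 1 - ofCoeffs O c

theorem map_marked (f : A →+* A') (O : Finset (Term n)) (τ : Term n) (c : O → A) :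
    MvPolynomial.map f (marked O τ c) = marked O τ fun σ => f (c σ) := by
  simp [marked, ofCoeffs]

theorem coeff_marked {O : Finset (Term n)} {τ γ : Term n} (c : O → A) (hγ : γ ∉ O) :
    coeff γ (marked O τ c) = if τ = γ then 1 else 0 := by
  classical
  rw [marked, coeff_sub, coeff_ofCoeffs_of_notMem c hγ, sub_zero, coeff_monomial]

theorem eq_or_mem_of_coeff_marked_ne_zero {O : Finset (Term n)} {τ γ : Term n} {c : O → A}
    (h : coeff γ (marked O τ c) ≠ 0) : γ = τ ∨ γ ∈ O := by
  by_contra! H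
  rw [coeff_marked c H.2, if_neg (Ne.symm H.1)] at h
  exact h rfl

theorem map_sPoly (f : A →+* A') (α α' : Term n) (p q : MvPolynomial (Fin n) A) :
    MvPolynomial.map f (sPoly α α' p q) =
      sPoly α α' (MvPolynomial.map f p) (MvPolynomial.map f q) := by
  simp [sPoly]

/-! ### Reductions -/

/-- The module generated by the multiples `η f_α`, with `η` multiplicative for `α`. -/
def ReductionStructure.multSpan (R : ReductionStructure n)
    (F : R.head → MvPolynomial (Fin n) A) : Submodule A (MvPolynomial (Fin n) A) :=
  Submodule.span A {p | ∃ (α : R.head) (η : Term n), η ∈ R.mult α ∧ p = monomial η 1 * F α}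

theorem ReductionStructure.mul_mem_multSpan {R : ReductionStructure n}
    (F : R.head → MvPolynomial (Fin n) A) {α : R.head} {η : Term n} (hη : η ∈ R.mult α) :
    monomial η 1 * F α ∈ R.multSpan F :=
  Submodule.subset_span ⟨α, η, hη, rfl⟩

theorem ReductionStructure.multSpan_subset_span {R : ReductionStructure n}
    {F : R.head → MvPolynomial (Fin n) A} {p : MvPolynomial (Fin n) A} (hp : p ∈ R.multSpan F) :
    p ∈ Ideal.span (Set.range F) := by
  have h : R.multSpan F ≤ (Ideal.span (Set.range F)).restrictScalars A := by
    refine Submodule.span_le.mpr ?_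
    rintro _ ⟨α, η, -, rfl⟩
    exact Ideal.mul_mem_left _ _ (Ideal.subset_span ⟨α, rfl⟩)
  exact h hp

/-- A specialization may annihilate the coefficient used in a step, so the image of a reduction need
not be a reduction. What survives is that the difference is a combination of multiplicative
multiples. -/
theorem ReductionStructure.Reduces.map_sub_mem {R : ReductionStructure n}
    {F : R.head → MvPolynomial (Fin n) A} {g h : MvPolynomial (Fin n) A} (H : R.Reduces F g h)
    (f : A →+* A') :
    MvPolynomial.map f g - MvPolynomial.map f h ∈
      R.multSpan fun α => MvPolynomial.map f (F α) := by
  induction H with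
  | refl => simp
  | tail _ hstep ih =>
    obtain ⟨α, η, hη, -, rfl⟩ := hstep
    rw [map_sub, ← sub_add, _root_.map_mul, map_monomial]
    refine Submodule.add_mem _ ih ?_
    have := Submodule.smul_mem _ (f (coeff (η + (α : Term n)) ‹_›))
      (R.mul_mem_multSpan (fun α => MvPolynomial.map f (F α)) hη)
    rwa [← smul_mul_assoc, smul_monomial, smul_eq_mul, mul_one] at this

theorem ReductionStructure.Reduces.sub_mem {R : ReductionStructure n}
    {F : R.head → MvPolynomial (Fin n) A} {g h : MvPolynomial (Fin n) A} (H : R.Reduces F g h) :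
    g - h ∈ R.multSpan F := by
  simpa only [map_id] using H.map_sub_mem (RingHom.id A)

theorem sPoly_mem_span {ι : Type*} (F : ι → MvPolynomial (Fin n) A) (α α' : Term n) (r s : ι) :
    sPoly α α' (F r) (F s) ∈ Ideal.span (Set.range F) :=
  Ideal.sub_mem _ (Ideal.mul_mem_left _ _ (Ideal.subset_span ⟨r, rfl⟩))
    (Ideal.mul_mem_left _ _ (Ideal.subset_span ⟨s, rfl⟩))

theorem ReductionStructure.Reduces.mem_span {R : ReductionStructure n}
    {F : R.head → MvPolynomial (Fin n) A} {g h : MvPolynomial (Fin n) A} (H : R.Reduces F g h)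
    (hg : g ∈ Ideal.span (Set.range F)) : h ∈ Ideal.span (Set.range F) := by
  have := Ideal.sub_mem _ hg (R.multSpan_subset_span H.sub_mem)
  rwa [sub_sub_cancel] at this

theorem map_mem_span_range {ι : Type*} {F : ι → MvPolynomial (Fin n) A}
    {h : MvPolynomial (Fin n) A} (hh : h ∈ Ideal.span (Set.range F)) (f : A →+* A') :
    MvPolynomial.map f h ∈ Ideal.span (Set.range fun i => MvPolynomial.map f (F i)) := by
  have := Ideal.mem_map_of_mem (MvPolynomial.map f) hh
  rwa [Ideal.map_span, ← Set.range_comp] at this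

/-- Simultaneous reduction of the terms `w α`, for a fixed term `w`. -/
theorem ReductionStructure.reduces_sub_sum (R : ReductionStructure n)
    (F : R.head → MvPolynomial (Fin n) A) (w : Term n) (S : Finset R.head)
    (hS : ∀ α ∈ S, w ∈ R.mult α)
    (hF : ∀ α β : R.head, α ≠ β → coeff (β : Term n) (F α) = 0) (g : MvPolynomial (Fin n) A) :
    R.Reduces F g (g - ∑ α ∈ S, monomial w (coeff (w + (α : Term n)) g) * F α) := by
  classical
  induction S using Finset.induction_on with
  | empty =>
    rw [Finset.sum_empty, sub_zero]
    exact Relation.ReflTransGen.refl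
  | insert a S ha ih =>
    have ih := ih fun α hα => hS α (Finset.mem_insert_of_mem hα)
    -- The steps do not interfere: no `F α` contains another head term, so the earlier subtractions
    -- leave the coefficient of `w a` unchanged.
    have hc : coeff (w + (a : Term n))
        (g - ∑ α ∈ S, monomial w (coeff (w + (α : Term n)) g) * F α) =
        coeff (w + (a : Term n)) g := by
      rw [coeff_sub, coeff_sum, Finset.sum_eq_zero, sub_zero]
      intro α hα
      rw [coeff_monomial_mul, hF α a (by rintro rfl; exact ha hα), mul_zero]
    rw [Finset.sum_insert ha, add_comm, ← sub_sub]
    by_cases h0 : coeff (w + (a : Term n)) g = 0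
    · simpa [h0] using ih
    · exact ih.tail ⟨a, w, hS a (Finset.mem_insert_self _ _), by rwa [hc], by rw [hc]⟩

/-! ### Border bases -/

theorem ofCoeffs_single {O : Finset (Term n)} [DecidableEq O] (σ : O) (a : A) :
    ofCoeffs O (Pi.single σ a) = monomial (σ : Term n) a := by
  rw [ofCoeffs, Finset.sum_eq_single σ]
  · simp
  · intro b _ hb
    simp [Pi.single_eq_of_ne hb]
  · simp

theorem ofCoeffs_add {O : Finset (Term n)} (v w : O → A) :
    ofCoeffs O (v + w) = ofCoeffs O v + ofCoeffs O w := by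
  simp [ofCoeffs, Finset.sum_add_distrib]

theorem ofCoeffs_smul {O : Finset (Term n)} (a : A) (v : O → A) :
    ofCoeffs O (a • v) = a • ofCoeffs O v := by
  simp [ofCoeffs, Finset.smul_sum, smul_monomial]

theorem notMem_of_mem_border {O : Finset (Term n)} {τ : Term n} (h : τ ∈ border O) : τ ∉ O :=
  (Finset.mem_sdiff.mp h).2

theorem var_add_mem_border {O : Finset (Term n)} {σ : Term n} (hσ : σ ∈ O) (i : Fin n)
    (h : var i + σ ∉ O) : var i + σ ∈ border O :=
  Finset.mem_sdiff.mpr ⟨Finset.mem_image.mpr ⟨(i, σ),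
    Finset.mem_product.mpr ⟨Finset.mem_univ _, hσ⟩, rfl⟩, h⟩

theorem var_add_mem_or {O : Finset (Term n)} {σ : Term n} (hσ : σ ∈ O) (i : Fin n) :
    var i + σ ∈ O ∨ var i + σ ∈ border O :=
  or_iff_not_imp_left.mpr (var_add_mem_border hσ i)

theorem exists_var_add_of_mem_border {O : Finset (Term n)} {τ : Term n} (h : τ ∈ border O) :
    ∃ i, ∃ σ ∈ O, τ = var i + σ := by
  obtain ⟨⟨i, σ⟩, hp, rfl⟩ := Finset.mem_image.mp (Finset.mem_sdiff.mp h).1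
  exact ⟨i, σ, (Finset.mem_product.mp hp).2, rfl⟩

open Classical in
/-- The coefficient vector of the one-step reduction of a term in `O ∪ ∂O`. -/
def borderVec {O : Finset (Term n)} (c : border O → O → A) (γ : Term n) : O → A :=
  if h : γ ∈ O then Pi.single ⟨γ, h⟩ 1 else if h : γ ∈ border O then c ⟨γ, h⟩ else 0

/-- The coefficient vector of the one-step reduction of a polynomial with support in `O ∪ ∂O`. -/
def borderRed {O : Finset (Term n)} (c : border O → O → A) :
    MvPolynomial (Fin n) A →ₗ[A] (O → A) :=
  (basisMonomials (Fin n) A).constr A (borderVec c)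

/-! ### Formal multiplication matrices and their commutation -/

section BorderRed

variable {O : Finset (Term n)} (c : border O → O → A)

theorem borderRed_monomial (γ : Term n) : borderRed c (monomial γ 1) = borderVec c γ := by
  have h := (basisMonomials (Fin n) A).constr_basis A (borderVec c) γ
  rw [borderRed]
  simpa only [coe_basisMonomials] using h

theorem borderRed_of_mem [DecidableEq O] (σ : O) :
    borderRed c (monomial (σ : Term n) 1) = Pi.single σ 1 := by
  rw [borderRed_monomial, borderVec, dif_pos σ.2]
  congr!

theorem borderRed_of_mem_border (τ : border O) :
    borderRed c (monomial (τ : Term n) 1) = c τ := by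
  rw [borderRed_monomial, borderVec, dif_neg (notMem_of_mem_border τ.2), dif_pos τ.2]

theorem borderRed_ofCoeffs (v : O → A) : borderRed c (ofCoeffs O v) = v := by
  classical
  have h : ∀ σ : O, borderRed c (monomial (σ : Term n) (v σ)) = v σ • Pi.single σ 1 := by
    intro σ
    rw [← borderRed_of_mem c, ← LinearMap.map_smul, smul_monomial, smul_eq_mul, mul_one]
  rw [ofCoeffs, map_sum, Finset.sum_congr rfl fun σ _ => h σ]
  ext σ
  simp [Pi.single_apply]

theorem borderRed_marked (τ : border O) : borderRed c (marked O τ (c τ)) = 0 := by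
  rw [marked, map_sub, borderRed_of_mem_border, borderRed_ofCoeffs, sub_self]

/-- The `i`-th formal multiplication matrix. -/
def multOp (i : Fin n) : Module.End A (O → A) where
  toFun v := borderRed c (X i * ofCoeffs O v)
  map_add' v w := by rw [ofCoeffs_add, mul_add, map_add]
  map_smul' a v := by rw [ofCoeffs_smul, mul_smul_comm, map_smul, RingHom.id_apply]

theorem multOp_apply (i : Fin n) (v : O → A) :
    multOp c i v = borderRed c (X i * ofCoeffs O v) := rfl

theorem X_mul_monomial (i : Fin n) (γ : Term n) (a : A) :
    (X i * monomial γ a : MvPolynomial (Fin n) A) = monomial (var i + γ) a := by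
  rw [X, monomial_mul, one_mul]

theorem multOp_single [DecidableEq O] (i : Fin n) (σ : O) :
    multOp c i (Pi.single σ 1) = borderRed c (monomial (var i + (σ : Term n)) 1) := by
  rw [multOp_apply, ofCoeffs_single, X_mul_monomial]

theorem ofCoeffs_multOp_single_of_mem [DecidableEq O] (i : Fin n) (σ : O)
    (h : var i + (σ : Term n) ∈ O) :
    ofCoeffs O (multOp c i (Pi.single σ 1)) = monomial (var i + (σ : Term n)) 1 := by
  rw [multOp_single, borderRed_of_mem c ⟨_, h⟩, ofCoeffs_single]

theorem ofCoeffs_multOp_single_of_notMem [DecidableEq O] (i : Fin n) (σ : O)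
    (h : var i + (σ : Term n) ∈ border O) :
    ofCoeffs O (multOp c i (Pi.single σ 1)) =
      monomial (var i + (σ : Term n)) 1 - marked O (var i + (σ : Term n)) (c ⟨_, h⟩) := by
  rw [multOp_single, borderRed_of_mem_border c ⟨_, h⟩, marked, sub_sub_cancel]

theorem sup_var_add {i j : Fin n} (hij : i ≠ j) (σ : Term n) :
    (var i + σ) ⊔ (var j + σ) = var i + var j + σ := by
  ext k
  simp only [Finsupp.sup_apply, Finsupp.add_apply, Finsupp.single_apply]
  split_ifs <;> omega

theorem sPoly_across {i j : Fin n} (hij : i ≠ j) (σ : Term n) (f f' : MvPolynomial (Fin n) A) :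
    sPoly (var i + σ) (var j + σ) f f' = X j * f - X i * f' := by
  rw [sPoly, sup_var_add hij]
  congr 3
  · rw [show var i + var j + σ = var j + (var i + σ) by abel, add_tsub_cancel_right]
  · rw [show var i + var j + σ = var i + (var j + σ) by abel, add_tsub_cancel_right]

theorem sPoly_next (j : Fin n) (σ : Term n) (f f' : MvPolynomial (Fin n) A) :
    sPoly (var j + σ) σ f f' = f - X j * f' := by
  rw [sPoly, sup_eq_left.mpr (le_add_of_nonneg_left zero_le), tsub_self, add_tsub_cancel_right,
    monomial_zero', C_1, one_mul, ← X]

variable (hS : ∀ r s : border O, IsNeighbourCouple (r : Term n) s →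
  borderRed c (sPoly r s (marked O r (c r)) (marked O s (c s))) = 0)

include hS

/-- Both products send the basis vector of `σ` to the one-step reduction of `x_i x_j σ`, up to
multiples of border polynomials by one variable. These corrections vanish or agree by the hypothesis
on neighbour couples. -/
theorem multOp_comm (hO : IsLowerSet (O : Set (Term n))) (i j : Fin n) :
    multOp c i * multOp c j = multOp c j * multOp c i := by
  classical
  rcases eq_or_ne i j with rfl | hij
  · rfl
  have next : ∀ (i j : Fin n) (σ : O), var i + (σ : Term n) ∈ O →
      ∀ h : var j + (σ : Term n) ∈ border O,
      borderRed c (X i * marked O (var j + (σ : Term n)) (c ⟨_, h⟩)) = 0 := by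
    intro i j σ hi h
    -- The term is a variable times `x_i σ ∈ O`, and it is outside `O` because `x_j σ` divides it.
    -- So it forms a neighbour couple with `x_j σ`.
    have hb : var i + (var j + (σ : Term n)) ∈ border O := by
      have hm : var j + (var i + (σ : Term n)) ∉ O := fun hm =>
        notMem_of_mem_border h (hO (by gcongr; exact le_add_of_nonneg_left zero_le) hm)
      have := var_add_mem_border hi j hm
      rwa [add_left_comm] at this
    have h1 := hS ⟨_, hb⟩ ⟨_, h⟩ (Or.inl ⟨i, rfl⟩)
    rw [sPoly_next, map_sub, borderRed_marked c ⟨_, hb⟩, zero_sub, neg_eq_zero] at h1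
    exact h1
  refine (Pi.basisFun A O).ext fun σ => ?_
  rw [Pi.basisFun_apply, Module.End.mul_apply, Module.End.mul_apply, multOp_apply c i (multOp c j _),
    multOp_apply c j (multOp c i _)]
  have hcomm : (X i * monomial (var j + (σ : Term n)) 1 : MvPolynomial (Fin n) A) =
      X j * monomial (var i + (σ : Term n)) 1 := by
    rw [X_mul_monomial, X_mul_monomial, add_left_comm]
  rcases var_add_mem_or σ.2 i with hi | hi <;> rcases var_add_mem_or σ.2 j with hj | hj
  · rw [ofCoeffs_multOp_single_of_mem c i σ hi, ofCoeffs_multOp_single_of_mem c j σ hj, hcomm]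
  · rw [ofCoeffs_multOp_single_of_mem c i σ hi, ofCoeffs_multOp_single_of_notMem c j σ hj,
      mul_sub, map_sub, next i j σ hi hj, sub_zero, hcomm]
  · rw [ofCoeffs_multOp_single_of_notMem c i σ hi, ofCoeffs_multOp_single_of_mem c j σ hj,
      mul_sub, map_sub, next j i σ hj hi, sub_zero, hcomm]
  · rw [ofCoeffs_multOp_single_of_notMem c i σ hi, ofCoeffs_multOp_single_of_notMem c j σ hj,
      mul_sub, mul_sub, map_sub, map_sub, hcomm]
    congr 1
    have h1 := hS ⟨_, hi⟩ ⟨_, hj⟩ (Or.inr ⟨j, i, by simp only; rw [add_left_comm]⟩)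
    rw [sPoly_across hij, map_sub, sub_eq_zero] at h1
    exact h1.symm

open scoped IsMulCommutative in
/-- If the `S`-polynomials of the neighbour couples reduce to `0`, then `A[x]` is an extension of
the free module on `O` by the ideal generated by the border marked set. -/
theorem exists_borderEval (hO : IsLowerSet (O : Set (Term n))) (h0 : 0 ∈ O) :
    ∃ Φ : MvPolynomial (Fin n) A →ₗ[A] (O → A),
      (∀ v, Φ (ofCoeffs O v) = v) ∧
      ∀ p ∈ Ideal.span (Set.range fun τ : border O => marked O (τ : Term n) (c τ)), Φ p = 0 := by
  classical
  have hcomm : ∀ a ∈ Set.range (multOp c), ∀ b ∈ Set.range (multOp c), a * b = b * a := by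
    rintro _ ⟨i, rfl⟩ _ ⟨j, rfl⟩
    exact multOp_comm c hS hO i j
  have := Algebra.isMulCommutative_adjoin A hcomm
  -- `aeval` needs a commutative target, hence the detour through the subalgebra generated by the
  -- commuting matrices.
  let ev : MvPolynomial (Fin n) A →ₐ[A] Algebra.adjoin A (Set.range (multOp c)) :=
    aeval (R := A) fun i => ⟨multOp c i, Algebra.subset_adjoin ⟨i, rfl⟩⟩
  let ev' : MvPolynomial (Fin n) A →ₐ[A] Module.End A (O → A) :=
    (Algebra.adjoin A (Set.range (multOp c))).val.comp ev
  have hX : ∀ i, ev' (X i) = multOp c i := by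
    intro i
    simp [ev', ev]
  let Φ : MvPolynomial (Fin n) A →ₗ[A] (O → A) :=
    (LinearMap.applyₗ (Pi.single ⟨0, h0⟩ 1 : O → A)).comp ev'.toLinearMap
  have hΦ : ∀ p, Φ p = ev' p (Pi.single ⟨0, h0⟩ 1) := fun p => rfl
  have hmul : ∀ p q, Φ (p * q) = ev' p (Φ q) := by
    intro p q
    rw [hΦ, hΦ, _root_.map_mul, Module.End.mul_apply]
  -- Every term of `O` is reached from 1 by multiplying by variables without leaving `O`, and there
  -- the matrices act as plain multiplication.
  have hmem : ∀ (d : ℕ) (σ : O), (σ : Term n).degree = d →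
      Φ (monomial (σ : Term n) 1) = Pi.single σ 1 := by
    intro d
    induction d with
    | zero =>
      intro σ hσ
      obtain rfl : σ = ⟨0, h0⟩ := Subtype.ext ((Finsupp.degree_eq_zero_iff _).mp hσ)
      rw [hΦ, monomial_zero', C_1, _root_.map_one, Module.End.one_apply]
    | succ d ih =>
      intro σ hσ
      have hne : (σ : Term n) ≠ 0 := by
        intro h
        rw [h] at hσ
        simp at hσ
      have hadd : var (minVar _ hne) + ((σ : Term n) - var (minVar _ hne)) = σ :=
        add_tsub_cancel_of_le (var_minVar_le hne)
      have hm : (σ : Term n) - var (minVar _ hne) ∈ O := hO tsub_le_self σ.2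
      have hd : ((σ : Term n) - var (minVar _ hne)).degree = d := by
        have := congrArg Finsupp.degree hadd
        rw [map_add, hσ] at this
        simp at this
        omega
      have h1 := ih ⟨_, hm⟩ hd
      conv_lhs => rw [← hadd, ← X_mul_monomial]
      rw [hmul, h1, hX, multOp_single]
      simp only [hadd]
      exact borderRed_of_mem c σ
  have hof : ∀ v, Φ (ofCoeffs O v) = v := by
    intro v
    have h : ∀ σ : O, Φ (monomial (σ : Term n) (v σ)) = v σ • Pi.single σ 1 := by
      intro σ
      rw [← hmem _ σ rfl, ← LinearMap.map_smul, smul_monomial, smul_eq_mul, mul_one]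
    rw [ofCoeffs, map_sum, Finset.sum_congr rfl fun σ _ => h σ]
    ext σ
    simp [Pi.single_apply]
  have hker : ∀ τ : border O, Φ (marked O (τ : Term n) (c τ)) = 0 := by
    intro τ
    obtain ⟨i, σ, hσ, hτ⟩ := exists_var_add_of_mem_border τ.2
    have h1 := borderRed_of_mem_border c τ
    rw [marked, map_sub, hof, sub_eq_zero, ← h1, hτ, ← X_mul_monomial, hmul,
      hmem _ ⟨σ, hσ⟩ rfl, hX, multOp_single, X_mul_monomial]
  refine ⟨Φ, hof, fun p hp => ?_⟩
  induction hp using Submodule.span_induction with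
  | mem _ h => obtain ⟨τ, rfl⟩ := h; exact hker τ
  | zero => simp
  | add x y _ _ hx hy => rw [map_add, hx, hy, add_zero]
  | smul a x _ hx => rw [smul_eq_mul, hmul, hx, map_zero]

theorem eq_zero_of_isReduced_of_mem_borderSpan (hO : IsLowerSet (O : Set (Term n))) (h0 : 0 ∈ O)
    {h : MvPolynomial (Fin n) A} (hr : IsReduced O h)
    (hh : h ∈ Ideal.span (Set.range fun τ : border O => marked O (τ : Term n) (c τ))) :
    h = 0 := by
  obtain ⟨Φ, h1, h2⟩ := exists_borderEval c hS hO h0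
  have h3 := h2 h hh
  rw [hr.eq_ofCoeffs, h1] at h3
  rw [hr.eq_ofCoeffs, h3]
  simp [ofCoeffs]

end BorderRed

/-! ### Reduction of the S-polynomials of neighbour couples -/

/-- The `S`-polynomials of neighbour couples have support in `O ∪ ∂O`. -/
theorem coeff_sPoly_neighbour {O : Finset (Term n)} (c : border O → O → A) {r s : border O}
    (hrs : IsNeighbourCouple (r : Term n) s) {γ : Term n} (hγ : γ ∉ O) (hγ' : γ ∉ border O) :
    coeff γ (sPoly r s (marked O r (c r)) (marked O s (c s))) = 0 := by
  classical
  have hX : ∀ (i : Fin n) (v : O → A), coeff γ (X i * ofCoeffs O v) = 0 := by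
    intro i v
    rw [ofCoeffs, Finset.mul_sum, coeff_sum]
    refine Finset.sum_eq_zero fun σ _ => ?_
    rw [X_mul_monomial, coeff_monomial, if_neg]
    rintro rfl
    exact (var_add_mem_or σ.2 i).elim hγ hγ'
  have hb : ∀ τ : border O, coeff γ (monomial (τ : Term n) (1 : A)) = 0 := by
    intro τ
    rw [coeff_monomial, if_neg]
    rintro rfl
    exact hγ' τ.2
  rcases hrs with ⟨j, hj⟩ | ⟨i, j, hij⟩
  · have h1 : sPoly (r : Term n) s (marked O r (c r)) (marked O s (c s)) =
        marked O r (c r) - X j * marked O s (c s) := by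
      rw [← sPoly_next j (s : Term n), ← hj]
    rw [h1, coeff_sub, marked, marked, mul_sub, coeff_sub, coeff_sub, hX, X_mul_monomial, ← hj, hb,
      coeff_ofCoeffs_of_notMem _ hγ]
    simp
  · rcases eq_or_ne r s with rfl | hne
    · simp [sPoly]
    · have hne' : i ≠ j := by
        rintro rfl
        exact hne (Subtype.ext (add_left_cancel hij))
      have hsup : (r : Term n) ⊔ s = var i + r := by
        ext k
        have hk := DFunLike.congr_fun hij k
        simp only [Finsupp.sup_apply, Finsupp.add_apply, Finsupp.single_apply] at hk ⊢
        split_ifs at hk ⊢ <;> omega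
      rw [sPoly, hsup, add_tsub_cancel_right, hij, add_tsub_cancel_right, ← X, ← X, coeff_sub,
        marked, marked, mul_sub, mul_sub, coeff_sub, coeff_sub, hX, hX, X_mul_monomial,
        X_mul_monomial, hij]
      simp

/-- The `S`-polynomials of neighbour couples reduce to `O`-reduced polynomials. -/
theorem exists_reduces_sPoly_neighbour {O : Finset (Term n)} (hO : IsLowerSet (O : Set (Term n)))
    (β : Fin (border O).card ≃ border O) (hβ : Monotone fun i => (β i : Term n).degree)
    (c : border O → O → A) {r s : border O} (hrs : IsNeighbourCouple (r : Term n) s) :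
    ∃ a : border O → A,
      IsReduced O (sPoly r s (marked O r (c r)) (marked O s (c s)) -
        ∑ τ, monomial 0 (a τ) * marked O (τ : Term n) (c τ)) ∧
      (borderRS O hO β).Reduces (fun τ => marked O (τ : Term n) (c τ))
        (sPoly r s (marked O r (c r)) (marked O s (c s)))
        (sPoly r s (marked O r (c r)) (marked O s (c s)) -
          ∑ τ, monomial 0 (a τ) * marked O (τ : Term n) (c τ)) := by
  classical
  set S := sPoly r s (marked O r (c r)) (marked O s (c s))
  have hne : ∀ α τ : border O, α ≠ τ → coeff (τ : Term n) (marked O (α : Term n) (c α)) = 0 := by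
    intro α τ h
    rw [coeff_marked _ (notMem_of_mem_border τ.2), if_neg fun h' => h (Subtype.ext h')]
  -- One simultaneous reduction with multiplier 1 (exponent `0`) clears all border terms, since the
  -- support lies in `O ∪ ∂O`.
  refine ⟨fun τ => coeff (0 + (τ : Term n)) S, ?_, ?_⟩
  · rw [isReduced_iff]
    intro γ hγ
    rw [coeff_sub, coeff_sum]
    by_cases hγ' : γ ∈ border O
    · rw [Finset.sum_eq_single ⟨γ, hγ'⟩]
      · simp only [monomial_zero', coeff_C_mul, zero_add]
        rw [coeff_marked _ hγ, if_pos rfl, mul_one, sub_self]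
      · intro b _ hb
        rw [monomial_zero', coeff_C_mul, hne b ⟨γ, hγ'⟩ hb, mul_zero]
      · simp
    · rw [coeff_sPoly_neighbour c hrs hγ hγ', Finset.sum_eq_zero, sub_zero]
      intro τ _
      rw [monomial_zero', coeff_C_mul, coeff_marked _ hγ, if_neg, mul_zero]
      rintro rfl
      exact hγ' τ.2
  · refine (borderRS O hO β).reduces_sub_sum (fun τ => marked O (τ : Term n) (c τ)) 0
      (Finset.univ : Finset (border O)) ?_ hne S
    -- The labelling by non-decreasing degree makes 1 multiplicative: a later border term dividing
    -- `b` has at least the degree of `b`, so it equals `b`.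
    intro b _ j hj hle
    rw [add_zero] at hle
    have hd : (b : Term n).degree ≤ (β j : Term n).degree :=
      (congrArg (fun τ : border O => (τ : Term n).degree) (β.apply_symm_apply b)).symm.le.trans
        (hβ hj.le)
    have heq : (β j : Term n) = (b : Term n) := by
      have hadd := add_tsub_cancel_of_le hle
      have h1 := congrArg Finsupp.degree hadd
      rw [map_add] at h1
      have h2 : ((b : Term n) - β j).degree = 0 := by omega
      rw [(Finsupp.degree_eq_zero_iff _).mp h2, add_zero] at hadd
      exact hadd
    have : β j = b := Subtype.ext heq
    rw [← this, Equiv.symm_apply_apply] at hj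
    exact lt_irrefl _ hj

/-! ### Pommaret bases -/

/-- The terms in the variables `x_1, ..., min(α)`. -/
def lowerTerms (α : Term n) : Set (Term n) :=
  {μ | ∀ h : α ≠ 0, ∀ i ∈ μ.support, i ≤ minVar α h}

/-- The reverse lexicographic position of a term: the highest variable is compared first. -/
def colexKey (η : Term n) : Colex (Fin n → ℕ) := toColex η

theorem colexKey_injective : Function.Injective (colexKey (n := n)) :=
  toColex.injective.comp DFunLike.coe_injective

theorem colexKey_lt_iff {η η' : Term n} :
    colexKey η < colexKey η' ↔ ∃ i, (∀ j, i < j → η j = η' j) ∧ η i < η' i :=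
  Iff.rfl

theorem apply_eq_zero_of_lt_minVar {α : Term n} (h : α ≠ 0) {i : Fin n} (hi : i < minVar α h) :
    α i = 0 := by
  by_contra hne
  exact absurd (minVar_le h (Finsupp.mem_support_iff.mpr hne)) (not_le.mpr hi)

theorem apply_eq_zero_of_mem_lowerTerms {α η : Term n} (hη : η ∈ lowerTerms α) (h : α ≠ 0)
    {i : Fin n} (hi : minVar α h < i) : η i = 0 := by
  by_contra hne
  exact absurd (hη h i (Finsupp.mem_support_iff.mpr hne)) (not_le.mpr hi)

/-- A variable above `min(α)` in `η'` decides the comparison, as `η` has none. Otherwise `α` and `σ`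
agree above `min(α)` and `α` is trivial below it, so `α ∤ σ` forces the exponent of `min(α)` to be
smaller in `η` than in `η'`. -/
theorem colexKey_lt_of_add_eq {α η η' σ : Term n} (hη : η ∈ lowerTerms α)
    (heq : η + α = η' + σ) (hle : ¬ α ≤ σ) : colexKey η < colexKey η' := by
  have h0 : α ≠ 0 := by
    rintro rfl
    exact hle zero_le
  have hk : ∀ k, η k + α k = η' k + σ k := fun k => DFunLike.congr_fun heq k
  by_cases hex : ∃ i, minVar α h0 < i ∧ 0 < η' i
  · obtain ⟨i, hi, hmax⟩ := (Finset.univ.filter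
      fun i => minVar α h0 < i ∧ 0 < η' i).exists_max_image id (by simpa [Finset.Nonempty] using hex)
    simp only [Finset.mem_filter, Finset.mem_univ, true_and, id] at hi hmax
    refine colexKey_lt_iff.mpr ⟨i, fun j hj => ?_, ?_⟩
    · rw [apply_eq_zero_of_mem_lowerTerms hη h0 (hi.1.trans hj)]
      by_contra hne
      exact absurd (hmax j ⟨hi.1.trans hj, by omega⟩) (not_le.mpr hj)
    · rw [apply_eq_zero_of_mem_lowerTerms hη h0 hi.1]
      exact hi.2
  · push Not at hex
    refine colexKey_lt_iff.mpr ⟨minVar α h0, fun j hj => ?_, ?_⟩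
    · have := hex j hj
      rw [apply_eq_zero_of_mem_lowerTerms hη h0 hj]
      omega
    · by_contra hlt
      apply hle
      intro k
      have := hk k
      rcases lt_trichotomy k (minVar α h0) with h | rfl | h
      · rw [apply_eq_zero_of_lt_minVar h0 h]
        exact zero_le
      · omega
      · have := hex k h
        have := apply_eq_zero_of_mem_lowerTerms hη h0 h
        omega

/-! ### Cones of the Pommaret basis -/

section Combinatorics

variable {O : Finset (Term n)} (hO : IsLowerSet (O : Set (Term n)))

include hO

theorem colexKey_lt_of_mem {α η η' σ : Term n} (hα : α ∈ pommaretBasis O) (hη : η ∈ lowerTerms α)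
    (hσ : σ ∈ O) (heq : η + α = η' + σ) : colexKey η < colexKey η' :=
  colexKey_lt_of_add_eq hη heq fun h => hα.1 (hO h hσ)

/-- An element of the Pommaret basis whose divisor `γ` is not in `O` has the same exponent at
its smallest variable as `γ`. -/
theorem apply_minVar_eq {α γ : Term n} (hα : α ∈ pommaretBasis O) (hγ : γ ∉ O) (hle : γ ≤ α)
    (h : α ≠ 0) : γ (minVar α h) = α (minVar α h) := by
  classical
  refine le_antisymm (hle _) ?_
  by_contra hlt
  refine hγ (hO ?_ (hα.2 h))
  intro k
  have := hle k
  rw [Finsupp.tsub_apply, Finsupp.single_apply]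
  split_ifs with hk
  · subst hk
    omega
  · simpa using this

/-- If `α'` has a larger exponent than `α` at `x_i`, then `x_i` divides `η`, so `i ≤ min(α) ≤
min(α') ≤ i`. But the two exponents agree at `min(α')` by `apply_minVar_eq`. -/
theorem eq_of_le_of_cone {α α' η η' : Term n} (hα : α ∈ pommaretBasis O)
    (hα' : α' ∈ pommaretBasis O) (hη : η ∈ lowerTerms α) (heq : η + α = η' + α')
    (hle : α ≤ α') : α = α' := by
  rcases eq_or_ne α' 0 with rfl | h'
  · exact le_antisymm hle zero_le
  have hm := apply_minVar_eq hO hα' hα.1 hle h'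
  have hpos := Finsupp.mem_support_iff.mp (minVar_mem h')
  refine le_antisymm hle fun i => ?_
  by_contra hlt
  have hi : η i + α i = η' i + α' i := DFunLike.congr_fun heq i
  have hi0 : η i ≠ 0 := by omega
  have h0 : α ≠ 0 := by
    rintro rfl
    exact hpos hm.symm
  have h1 : i ≤ minVar α h0 := hη h0 i (Finsupp.mem_support_iff.mpr hi0)
  have h2 : minVar α h0 ≤ minVar α' h' :=
    minVar_le h0 (Finsupp.mem_support_iff.mpr (by rwa [hm]))
  have h3 : minVar α' h' ≤ i := minVar_le h' (Finsupp.mem_support_iff.mpr (by omega))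
  obtain rfl : i = minVar α' h' := le_antisymm (h1.trans h2) h3
  omega

/-- The cones of the Pommaret basis are disjoint. -/
theorem pommaret_cone_unique {α α' η η' : Term n} (hα : α ∈ pommaretBasis O)
    (hα' : α' ∈ pommaretBasis O) (hη : η ∈ lowerTerms α) (hη' : η' ∈ lowerTerms α')
    (heq : η + α = η' + α') : α = α' := by
  by_cases h1 : α ≤ α'
  · exact eq_of_le_of_cone hO hα hα' hη heq h1
  by_cases h2 : α' ≤ α
  · exact (eq_of_le_of_cone hO hα' hα hη' heq.symm h2).symm
  -- If neither head divides the other, each multiplier would be strictly smaller than the other.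
  exact absurd (colexKey_lt_of_add_eq hη heq h1)
    (colexKey_lt_of_add_eq hη' heq.symm h2).not_gt

/-- The least common multiple of a non-multiplicative couple. -/
theorem sup_eq_of_nonMult {α α' δ : Term n} {i : Fin n} (hα : α ∈ pommaretBasis O)
    (hα' : α' ∈ pommaretBasis O) (hi : var i ∉ lowerTerms α) (hδ : δ ∈ lowerTerms α')
    (heq : var i + α = δ + α') : α ⊔ α' = var i + α := by
  have hi' : ∃ h : α ≠ 0, minVar α h < i := by
    by_contra! hcon
    refine hi fun h j hj => ?_
    obtain rfl : j = i := by simpa using Finsupp.support_single_subset hj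
    exact hcon h
  obtain ⟨h0, hlt⟩ := hi'
  have hk : ∀ k, var i k + α k = δ k + α' k := fun k => DFunLike.congr_fun heq k
  have hii := hk i
  have hoff : ∀ k, k ≠ i → α k = δ k + α' k := by
    intro k hki
    have := hk k
    rwa [var, Finsupp.single_eq_of_ne hki, zero_add] at this
  rw [var, Finsupp.single_eq_same] at hii
  -- If `x_i` divided `δ`, then `α'` would divide `α`, and `i ≤ min(α') ≤ min(α) < i`. Hence the
  -- whole exponent of `x_i` comes from `α'`.
  have hδi : δ i = 0 := by
    by_contra hne
    have hle : α' ≤ α := by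
      intro k
      rcases eq_or_ne k i with rfl | hki
      · omega
      · have := hoff k hki
        omega
    have hm := apply_minVar_eq hO hα hα'.1 hle h0
    have hpos := Finsupp.mem_support_iff.mp (minVar_mem h0)
    have h0' : α' ≠ 0 := by
      rintro rfl
      exact hpos hm.symm
    have h1 : i ≤ minVar α' h0' := hδ h0' i (Finsupp.mem_support_iff.mpr hne)
    have h2 : minVar α' h0' ≤ minVar α h0 :=
      minVar_le h0' (Finsupp.mem_support_iff.mpr (by rwa [hm]))
    exact absurd (h1.trans h2) (not_le.mpr hlt)
  ext k
  rw [Finsupp.sup_apply, Finsupp.add_apply]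
  rcases eq_or_ne k i with rfl | hki
  · rw [var, Finsupp.single_eq_same]
    omega
  · rw [var, Finsupp.single_eq_of_ne hki]
    have := hoff k hki
    omega

end Combinatorics

/-! ### Reduction and prolongation for Pommaret marked sets -/

section PommaretSpan

variable {O : Finset (Term n)} (hO : IsLowerSet (O : Set (Term n)))

/-- The `P_O`-marked set with given tail coefficients. -/
def pommaretMarked (c : pommaretBasis O → O → A) (α : (pommaretRS O hO).head) :
    MvPolynomial (Fin n) A :=
  marked O (α : Term n) (c α)

variable (c : pommaretBasis O → O → A)

theorem coeff_mul_marked_ne_zero {w τ γ : Term n} {a : A} {d : O → A}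
    (h : coeff γ (monomial w a * marked O τ d) ≠ 0) : γ = w + τ ∨ ∃ σ ∈ O, γ = w + σ := by
  classical
  rw [coeff_monomial_mul'] at h
  split_ifs at h with hle
  · have hadd : w + (γ - w) = γ := add_tsub_cancel_of_le hle
    rcases eq_or_mem_of_coeff_marked_ne_zero (right_ne_zero_of_mul h) with h1 | h1
    · exact Or.inl (by rw [← h1, hadd])
    · exact Or.inr ⟨_, h1, hadd.symm⟩
  · exact absurd rfl h

/-- `⟨O⟩` meets the span of the multiplicative multiples of a `P_O`-marked set in `0`. -/
theorem eq_zero_of_isReduced_of_mem_multSpan {p : MvPolynomial (Fin n) A}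
    (hr : IsReduced O p) (hp : p ∈ (pommaretRS O hO).multSpan (pommaretMarked hO c)) : p = 0 := by
  classical
  let I := Σ α : pommaretBasis O, lowerTerms (α : Term n)
  let v : I → MvPolynomial (Fin n) A := fun x => monomial (x.2 : Term n) 1 * marked O x.1 (c x.1)
  have hset : {q | ∃ (α : (pommaretRS O hO).head) (η : Term n), η ∈ (pommaretRS O hO).mult α ∧
      q = monomial η 1 * pommaretMarked hO c α} = Set.range v := by
    ext q
    constructor
    · rintro ⟨α, η, hη, rfl⟩
      exact ⟨⟨α, η, hη⟩, rfl⟩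
    · rintro ⟨⟨α, η, hη⟩, rfl⟩
      exact ⟨α, η, hη, rfl⟩
  rw [ReductionStructure.multSpan, hset, Finsupp.mem_span_range_iff_exists_finsupp] at hp
  obtain ⟨a, rfl⟩ := hp
  rcases a.support.eq_empty_or_nonempty with he | hne
  · rw [Finsupp.support_eq_empty.mp he, Finsupp.sum_zero_index]
  -- The head of a multiple with maximal multiplier cannot cancel: cones are disjoint, and it could
  -- occur in the tail of another multiple only if that one had a larger multiplier.
  obtain ⟨x, hx, hmax⟩ := a.support.exists_max_image (fun x : I => colexKey (x.2 : Term n)) hne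
  have hxO : ((x.2 : Term n) + (x.1 : Term n)) ∉ O := fun h =>
    x.1.2.1 (hO (le_add_of_nonneg_left zero_le) h)
  refine absurd ?_ (Finsupp.mem_support_iff.mp hx)
  have h0 := isReduced_iff.mp hr _ hxO
  rw [Finsupp.sum, coeff_sum, Finset.sum_eq_single x] at h0
  · rw [coeff_smul, coeff_monomial_mul, coeff_marked _ x.1.2.1, if_pos rfl] at h0
    simpa using h0
  · intro y hy hyx
    rw [coeff_smul]
    by_contra hcon
    rcases coeff_mul_marked_ne_zero (right_ne_zero_of_mul hcon) with h1 | ⟨σ, hσ, h1⟩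
    · obtain ⟨⟨α, hα⟩, ⟨η, hη⟩⟩ := x
      obtain ⟨⟨α', hα'⟩, ⟨η', hη'⟩⟩ := y
      obtain rfl := pommaret_cone_unique hO hα hα' hη hη' h1
      obtain rfl := add_right_cancel h1
      exact hyx rfl
    · exact absurd (hmax y hy) (not_le.mpr (colexKey_lt_of_mem hO x.1.2 x.2.2 hσ h1))
  · exact fun h => absurd hx h

open Classical in
/-- The position of the multiplier of a term outside `O` in the Pommaret decomposition. -/
def pommaretKey (O : Finset (Term n)) (γ : Term n) : WithBot (Colex (Fin n → ℕ)) :=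
  if h : γ ∉ O then colexKey (γ - (exists_pommaret_cone O γ h).choose) else ⊥

include hO in
theorem pommaretKey_eq {α η : Term n} (hα : α ∈ pommaretBasis O) (hη : η ∈ lowerTerms α) :
    pommaretKey O (η + α) = colexKey η := by
  have h : η + α ∉ O := fun h => hα.1 (hO (le_add_of_nonneg_left zero_le) h)
  rw [pommaretKey, dif_pos h]
  obtain ⟨h1, η', h2, h3⟩ := (exists_pommaret_cone O (η + α) h).choose_spec
  rw [← pommaret_cone_unique hO hα h1 hη h2 h3, add_tsub_cancel_right]

/-- Every polynomial reduces to an `O`-reduced one. -/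
theorem exists_pommaret_reduces (g : MvPolynomial (Fin n) A) :
    ∃ h, IsReduced O h ∧ (pommaretRS O hO).Reduces (pommaretMarked hO c) g h := by
  classical
  induction hw : g.support.sup (pommaretKey O) using WellFoundedLT.induction generalizing g with
  | ind w ih =>
  subst hw
  by_cases hr : IsReduced O g
  · exact ⟨g, hr, Relation.ReflTransGen.refl⟩
  have hne : g.support.Nonempty := by
    by_contra h
    rw [Finset.not_nonempty_iff_eq_empty] at h
    exact hr (by rw [IsReduced, h]; exact Finset.empty_subset _)
  obtain ⟨γ₁, hγ₁, hγ₁O⟩ := Finset.not_subset.mp hr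
  obtain ⟨γ₀, hγ₀, hsup⟩ := Finset.exists_mem_eq_sup _ hne (pommaretKey O)
  have hγ₀O : γ₀ ∉ O := by
    intro h
    have h1 : pommaretKey O γ₁ ≤ pommaretKey O γ₀ := hsup ▸ Finset.le_sup hγ₁
    obtain ⟨α, hα, η, hη, rfl⟩ := exists_pommaret_cone O γ₁ hγ₁O
    rw [pommaretKey_eq hO hα hη, pommaretKey, dif_neg (not_not.mpr h)] at h1
    simp at h1
  obtain ⟨α₀, hα₀, w, hw, rfl⟩ := exists_pommaret_cone O γ₀ hγ₀O
  rw [pommaretKey_eq hO hα₀ hw] at hsup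
  let _ : Fintype (pommaretRS O hO).head := (pommaretRS O hO).head_finite.fintype
  -- All terms with the maximal multiplier `w` are removed at once. The tails contribute outside `O`
  -- only terms with smaller multipliers, so the maximum strictly drops in a well-founded order.
  let S : Finset (pommaretRS O hO).head :=
    Finset.univ.filter fun α => w ∈ (pommaretRS O hO).mult α
  have hF : ∀ α β : (pommaretRS O hO).head, α ≠ β →
      coeff (β : Term n) (pommaretMarked hO c α) = 0 := by
    intro α β h
    rw [pommaretMarked, coeff_marked _ β.2.1, if_neg fun h' => h (Subtype.ext h')]
  have hred := (pommaretRS O hO).reduces_sub_sum (pommaretMarked hO c) w S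
    (fun α hα => (Finset.mem_filter.mp hα).2) hF g
  have hlt : (g - ∑ α ∈ S, monomial w (coeff (w + (α : Term n)) g) *
      pommaretMarked hO c α).support.sup (pommaretKey O) < g.support.sup (pommaretKey O) := by
    rw [hsup]
    refine (Finset.sup_lt_iff (WithBot.bot_lt_coe _)).mpr fun γ hγ => ?_
    by_cases hγO : γ ∈ O
    · rw [pommaretKey, dif_neg (not_not.mpr hγO)]
      exact WithBot.bot_lt_coe _
    obtain ⟨α, hα, η, hη, rfl⟩ := exists_pommaret_cone O γ hγO
    rw [pommaretKey_eq hO hα hη, WithBot.coe_lt_coe]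
    rw [mem_support_iff, coeff_sub, coeff_sum] at hγ
    have hηw : η ≠ w := by
      rintro rfl
      apply hγ
      rw [Finset.sum_eq_single (⟨α, hα⟩ : (pommaretRS O hO).head)]
      · rw [coeff_monomial_mul, pommaretMarked, coeff_marked _ hα.1, if_pos rfl, mul_one, sub_self]
      · intro β _ hβ
        rw [coeff_monomial_mul, hF β ⟨α, hα⟩ hβ, mul_zero]
      · intro h
        exact absurd (Finset.mem_filter_univ (⟨α, hα⟩ : (pommaretRS O hO).head) |>.mpr hη) h
    have hcase : coeff (η + α) g ≠ 0 ∨ ∃ β ∈ S, coeff (η + α)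
        (monomial w (coeff (w + (β : Term n)) g) * pommaretMarked hO c β) ≠ 0 := by
      by_contra! hcon
      exact hγ (by rw [hcon.1, Finset.sum_eq_zero hcon.2, sub_zero])
    rcases hcase with h1 | ⟨β, hβ, h1⟩
    · have h2 : pommaretKey O (η + α) ≤ colexKey w :=
        hsup ▸ Finset.le_sup (f := pommaretKey O) (mem_support_iff.mpr h1)
      rw [pommaretKey_eq hO hα hη, WithBot.coe_le_coe] at h2
      exact lt_of_le_of_ne h2 fun h => hηw (colexKey_injective h)
    · rcases coeff_mul_marked_ne_zero h1 with h2 | ⟨σ, hσ, h2⟩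
      · obtain rfl := pommaret_cone_unique hO hα β.2 hη (Finset.mem_filter.mp hβ).2 h2
        exact absurd (add_right_cancel h2) hηw
      · exact colexKey_lt_of_mem hO hα hη hσ h2
  obtain ⟨h, hh, hgh⟩ := ih _ hlt _ rfl
  exact ⟨h, hh, hred.trans hgh⟩

/-- If the non-multiplicative prolongations lie in the span of the multiplicative multiples,
then this span is an ideal. -/
theorem span_subset_multSpan
    (hprol : ∀ (α : (pommaretRS O hO).head) (i : Fin n), var i ∉ (pommaretRS O hO).mult α →
      X i * pommaretMarked hO c α ∈ (pommaretRS O hO).multSpan (pommaretMarked hO c))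
    {p : MvPolynomial (Fin n) A} (hp : p ∈ Ideal.span (Set.range (pommaretMarked hO c))) :
    p ∈ (pommaretRS O hO).multSpan (pommaretMarked hO c) := by
  set L := (pommaretRS O hO).multSpan (pommaretMarked hO c) with hL
  have hX : ∀ i : Fin n, ∀ p ∈ L, X i * p ∈ L := by
    intro i
    induction i using WellFoundedLT.induction with
    | ind i ih =>
    -- By induction on `i`, `L` is already stable under terms in the variables below `x_i`.
    have hterm : ∀ (d : ℕ) (η : Term n), η.degree = d → (∀ j ∈ η.support, j < i) →
        ∀ p ∈ L, monomial η 1 * p ∈ L := by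
      intro d
      induction d with
      | zero =>
        intro η hη _ p hp
        rw [(Finsupp.degree_eq_zero_iff _).mp hη, monomial_zero', C_1, one_mul]
        exact hp
      | succ d ihd =>
        intro η hη hlt p hp
        have hne : η ≠ 0 := by
          rintro rfl
          simp at hη
        have hadd : var (minVar _ hne) + (η - var (minVar _ hne)) = η :=
          add_tsub_cancel_of_le (var_minVar_le hne)
        have hd : (η - var (minVar _ hne)).degree = d := by
          have := congrArg Finsupp.degree hadd
          rw [map_add, hη] at this
          simp at this
          omega
        rw [← hadd, ← X_mul_monomial, mul_assoc]
        exact ih _ (hlt _ (minVar_mem hne)) _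
          (ihd _ hd (fun j hj => hlt j (Finsupp.support_mono tsub_le_self hj)) p hp)
    intro p hp
    rw [hL, ReductionStructure.multSpan] at hp
    induction hp using Submodule.span_induction with
    | zero => simp
    | add x y _ _ hx hy => rw [mul_add]; exact L.add_mem hx hy
    | smul a x _ hx => rw [mul_smul_comm]; exact L.smul_mem _ hx
    | mem q hq =>
      obtain ⟨α, η, hη, rfl⟩ := hq
      by_cases hi : var i ∈ (pommaretRS O hO).mult α
      · rw [← mul_assoc, X_mul_monomial]
        refine ReductionStructure.mul_mem_multSpan _ fun h j hj => ?_
        rcases Finset.mem_union.mp (Finsupp.support_add hj) with hj | hj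
        · exact hi h j hj
        · exact hη h j hj
      -- The prolongation `x_i f_α` lies in `L`, and the variables of `η` are at most `min(α) < i`,
      -- so `hterm` applies.
      · rw [mul_left_comm]
        refine hterm _ η rfl (fun j hj => ?_) _ (hprol α i hi)
        by_contra hij
        refine hi fun h k hk => ?_
        obtain rfl : k = i := by simpa using Finsupp.support_single_subset hk
        exact (not_lt.mp hij).trans (hη h j hj)
  have hmul : ∀ q : MvPolynomial (Fin n) A, ∀ p ∈ L, q * p ∈ L := by
    intro q
    induction q using MvPolynomial.induction_on with
    | C a => intro p hp; rw [C_mul']; exact L.smul_mem a hp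
    | add q₁ q₂ h₁ h₂ => intro p hp; rw [add_mul]; exact L.add_mem (h₁ p hp) (h₂ p hp)
    | mul_X q i h => intro p hp; rw [mul_assoc]; exact h _ (hX i p hp)
  induction hp using Submodule.span_induction with
  | zero => exact L.zero_mem
  | add x y _ _ hx hy => exact L.add_mem hx hy
  | smul a x _ hx => exact hmul a x hx
  | mem q hq =>
    obtain ⟨α, rfl⟩ := hq
    have := (pommaretRS O hO).mul_mem_multSpan (pommaretMarked hO c) (α := α) (η := 0)
      fun h i hi => by simp at hi
    rwa [monomial_zero', C_1, one_mul] at this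

include hO in
/-- For non-multiplicative couples, the `S`-polynomial is the difference of a prolongation and a
multiplicative multiple. -/
theorem sPoly_nonMult {α α' δ : Term n} {i : Fin n} (hα : α ∈ pommaretBasis O)
    (hα' : α' ∈ pommaretBasis O) (hi : var i ∉ lowerTerms α) (hδ : δ ∈ lowerTerms α')
    (heq : var i + α = δ + α') (f f' : MvPolynomial (Fin n) A) :
    sPoly α α' f f' = X i * f - monomial δ 1 * f' := by
  rw [sPoly, sup_eq_of_nonMult hO hα hα' hi hδ heq, add_tsub_cancel_right, heq,
    add_tsub_cancel_right, ← X]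

end PommaretSpan

variable {K : Type*} [Field K] {O : Finset (Term n)} (hO : IsLowerSet (O : Set (Term n)))

/-! ### Comparison of the marked schemes -/

/-- The border marked set obtained by specializing the parameters. -/
def specBorder (f : MvPolynomial (Param O) K →+* A) (τ : border O) : MvPolynomial (Fin n) A :=
  marked O (τ : Term n) fun σ => f (X (τ, σ))

/-- The Pommaret marked set obtained by specializing the parameters. -/
def specPommaret (f : MvPolynomial ↥(Ctilde O)ᶜ K →+* A) (α : (pommaretRS O hO).head) :
    MvPolynomial (Fin n) A :=
  pommaretMarked hO (fun α σ => f (X (pommaretParam O hO α σ))) α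

theorem map_genericBorderSet (β : Fin (border O).card ≃ border O)
    (f : MvPolynomial (Param O) K →+* A) (τ : border O) :
    MvPolynomial.map f (genericBorderSet K O hO β τ) = specBorder f τ :=
  map_marked f O (τ : Term n) fun σ => X (τ, σ)

theorem map_genericPommaretSet (f : MvPolynomial ↥(Ctilde O)ᶜ K →+* A)
    (α : (pommaretRS O hO).head) :
    MvPolynomial.map f (genericPommaretSet K O hO α) = specPommaret hO f α :=
  map_marked f O (α : Term n) fun σ => X (pommaretParam O hO α σ)

variable {hO}

theorem map_eq_zero_of_coeff_mem {I : Ideal A} {h : MvPolynomial (Fin n) A}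
    (H : ∀ σ, coeff σ h ∈ I) : MvPolynomial.map (Ideal.Quotient.mk I) h = 0 := by
  ext σ
  rw [coeff_map, coeff_zero]
  exact Ideal.Quotient.eq_zero_iff_mem.mpr (H σ)

variable (hO) in
-- One explicit reduction per neighbour couple suffices: modulo `𝔅` its result vanishes, so the
-- S-polynomial is a linear combination of border polynomials and `borderRed` kills it.
theorem eq_zero_of_mem_span_border (β : Fin (border O).card ≃ border O)
    (hβ : Monotone fun i => (β i : Term n).degree) (h0 : 0 ∈ O)
    {h : MvPolynomial (Fin n) (MvPolynomial (Param O) K ⧸ borderIdeal K O hO β)}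
    (hr : IsReduced O h)
    (hh : h ∈ Ideal.span (Set.range (specBorder (Ideal.Quotient.mk (borderIdeal K O hO β))))) :
    h = 0 := by
  refine eq_zero_of_isReduced_of_mem_borderSpan
    (fun τ σ => Ideal.Quotient.mk (borderIdeal K O hO β) (X (τ, σ))) ?_ hO h0 hr hh
  intro r s hrs
  obtain ⟨a, hred, hsteps⟩ := exists_reduces_sPoly_neighbour hO β hβ
    (fun τ σ => (X (τ, σ) : MvPolynomial (Param O) K)) hrs
  have hz := map_eq_zero_of_coeff_mem (I := borderIdeal K O hO β) fun σ =>
    Ideal.subset_span ⟨r, s, hrs, _, hred, hsteps, σ, rfl⟩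
  rw [map_sub, map_sPoly, map_marked, map_marked, sub_eq_zero] at hz
  rw [hz, map_sum, map_sum]
  refine Finset.sum_eq_zero fun τ _ => ?_
  rw [_root_.map_mul, map_monomial, map_marked, monomial_zero', C_mul', LinearMap.map_smul,
    borderRed_marked (fun τ σ => Ideal.Quotient.mk (borderIdeal K O hO β) (X (τ, σ))), smul_zero]

/-- Modulo `𝔓` the S-polynomial of a non-multiplicative couple lies in the span of multiplicative
multiples. Adding back `δ f_α'` puts the prolongation there too. -/
theorem span_pommaret_subset_multSpan {p : MvPolynomial (Fin n)
      (MvPolynomial ↥(Ctilde O)ᶜ K ⧸ pommaretIdeal K O hO)}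
    (hp : p ∈ Ideal.span (Set.range (specPommaret hO
      (Ideal.Quotient.mk (pommaretIdeal K O hO))))) :
    p ∈ (pommaretRS O hO).multSpan (specPommaret hO
      (Ideal.Quotient.mk (pommaretIdeal K O hO))) := by
  refine span_subset_multSpan hO _ ?_ hp
  intro α i hi
  have hO' : var i + (α : Term n) ∉ O := fun h => α.2.1 (hO (le_add_of_nonneg_left zero_le) h)
  obtain ⟨α', hα', δ, hδ, heq⟩ := exists_pommaret_cone O _ hO'
  obtain ⟨h, hred, hsteps⟩ := exists_pommaret_reduces hO
    (fun α σ => (X (pommaretParam O hO α σ) : MvPolynomial ↥(Ctilde O)ᶜ K))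
    (sPoly α α' (genericPommaretSet K O hO α) (genericPommaretSet K O hO ⟨α', hα'⟩))
  have hz := map_eq_zero_of_coeff_mem (I := pommaretIdeal K O hO) fun σ =>
    Ideal.subset_span ⟨α, ⟨α', hα'⟩, ⟨i, hi, δ, hδ, heq⟩, h, hred, hsteps, σ, rfl⟩
  have hmem := hsteps.map_sub_mem (Ideal.Quotient.mk (pommaretIdeal K O hO))
  rw [hz, sub_zero, map_sPoly, map_genericPommaretSet, map_genericPommaretSet,
    sPoly_nonMult hO α.2 hα' hi hδ heq] at hmem
  have h2 := (pommaretRS O hO).mul_mem_multSpan (specPommaret hO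
    (Ideal.Quotient.mk (pommaretIdeal K O hO))) (α := ⟨α', hα'⟩) hδ
  have h3 : (fun α => MvPolynomial.map (Ideal.Quotient.mk (pommaretIdeal K O hO))
      (pommaretMarked hO (fun α σ => (X (pommaretParam O hO α σ) :
        MvPolynomial ↥(Ctilde O)ᶜ K)) α)) =
      specPommaret hO (Ideal.Quotient.mk (pommaretIdeal K O hO)) :=
    funext fun α => map_genericPommaretSet hO _ α
  rw [h3] at hmem
  have h4 := Submodule.add_mem _ hmem h2
  rwa [sub_add_cancel] at h4

theorem eq_zero_of_mem_span_pommaret {h : MvPolynomial (Fin n)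
      (MvPolynomial ↥(Ctilde O)ᶜ K ⧸ pommaretIdeal K O hO)} (hr : IsReduced O h)
    (hh : h ∈ Ideal.span (Set.range (specPommaret hO
      (Ideal.Quotient.mk (pommaretIdeal K O hO))))) : h = 0 :=
  eq_zero_of_isReduced_of_mem_multSpan hO _ hr (span_pommaret_subset_multSpan hh)

/-- A specialization whose border marked set generates an ideal meeting `⟨O⟩` in `0` factors
through the border ideal. -/
theorem borderIdeal_le_ker {β : Fin (border O).card ≃ border O}
    (f : MvPolynomial (Param O) K →+* A)
    (hf : ∀ h, IsReduced O h → h ∈ Ideal.span (Set.range (specBorder f)) → h = 0) :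
    borderIdeal K O hO β ≤ RingHom.ker f := by
  refine Ideal.span_le.mpr ?_
  rintro _ ⟨r, s, -, h, hred, hsteps, σ, rfl⟩
  have h1 := map_mem_span_range (hsteps.mem_span (sPoly_mem_span _ _ _ r s)) f
  have h2 : (fun τ => MvPolynomial.map f (genericBorderSet K O hO β τ)) = specBorder f :=
    funext fun τ => map_genericBorderSet hO β f τ
  rw [h2] at h1
  rw [SetLike.mem_coe, RingHom.mem_ker, ← coeff_map, hf _ (hred.map f) h1, coeff_zero]

/-- A specialization whose Pommaret marked set generates an ideal meeting `⟨O⟩` in `0` factors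
through the Pommaret ideal. -/
theorem pommaretIdeal_le_ker (f : MvPolynomial ↥(Ctilde O)ᶜ K →+* A)
    (hf : ∀ h, IsReduced O h → h ∈ Ideal.span (Set.range (specPommaret hO f)) → h = 0) :
    pommaretIdeal K O hO ≤ RingHom.ker f := by
  refine Ideal.span_le.mpr ?_
  rintro _ ⟨r, s, -, h, hred, hsteps, σ, rfl⟩
  have h1 := map_mem_span_range (hsteps.mem_span (sPoly_mem_span _ _ _ r s)) f
  have h2 : (fun τ => MvPolynomial.map f (genericPommaretSet K O hO τ)) = specPommaret hO f :=
    funext fun τ => map_genericPommaretSet hO f τ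
  rw [h2] at h1
  rw [SetLike.mem_coe, RingHom.mem_ker, ← coeff_map, hf _ (hred.map f) h1, coeff_zero]

/-! ### Mutually inverse maps of coordinate rings -/

/-- The coordinate ring of `𝔸^(C \ C̃)` mapped to that of the border marked scheme. -/
def toBorderQuotient (β : Fin (border O).card ≃ border O) :
    MvPolynomial ↥(Ctilde O)ᶜ K →ₐ[K] MvPolynomial (Param O) K ⧸ borderIdeal K O hO β :=
  (Ideal.Quotient.mkₐ K (borderIdeal K O hO β)).comp
    (rename (R := K) (Subtype.val : ↥(Ctilde O)ᶜ → Param O))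

theorem toBorderQuotient_X {β : Fin (border O).card ≃ border O} (i : ↥(Ctilde O)ᶜ) :
    toBorderQuotient (hO := hO) β (X i : MvPolynomial _ K) =
      Ideal.Quotient.mk (borderIdeal K O hO β) (X i.1) := by
  simp [toBorderQuotient]

theorem span_specPommaret_le (β : Fin (border O).card ≃ border O) (h0 : 0 ∈ O) :
    Ideal.span (Set.range (specPommaret hO (toBorderQuotient (K := K) (hO := hO) β).toRingHom)) ≤
      Ideal.span (Set.range (specBorder (Ideal.Quotient.mk (borderIdeal K O hO β)))) := by
  refine Ideal.span_mono ?_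
  rintro _ ⟨α, rfl⟩
  refine ⟨⟨α, pommaretBasis_subset_border hO ⟨0, h0⟩ α.2⟩, ?_⟩
  rw [specBorder, specPommaret, pommaretMarked]
  congr 1
  funext σ
  exact (toBorderQuotient_X (pommaretParam O hO α σ)).symm

variable (hO) in
theorem exists_algHom_of_nonempty (β : Fin (border O).card ≃ border O)
    (hβ : Monotone fun i => (β i : Term n).degree) (h0 : 0 ∈ O) :
    pommaretIdeal K O hO ≤ RingHom.ker (toBorderQuotient (K := K) (hO := hO) β).toRingHom ∧
    ∃ ψ : MvPolynomial (Param O) K →ₐ[K] MvPolynomial ↥(Ctilde O)ᶜ K ⧸ pommaretIdeal K O hO,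
      borderIdeal K O hO β ≤ RingHom.ker ψ.toRingHom ∧
      (∀ i : ↥(Ctilde O)ᶜ, ψ (X i.1) = Ideal.Quotient.mk (pommaretIdeal K O hO) (X i)) ∧
      ∀ i : Param O, ∃ p, ψ (X i) = Ideal.Quotient.mk (pommaretIdeal K O hO) p ∧
        toBorderQuotient β p = Ideal.Quotient.mk (borderIdeal K O hO β) (X i) := by
  have hker : pommaretIdeal K O hO ≤
      RingHom.ker (toBorderQuotient (K := K) (hO := hO) β).toRingHom :=
    pommaretIdeal_le_ker _ fun h hr hh =>
      eq_zero_of_mem_span_border hO β hβ h0 hr (span_specPommaret_le β h0 hh)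
  refine ⟨hker, ?_⟩
  set q := Ideal.Quotient.mk (pommaretIdeal K O hO)
  -- Any `O`-reduced form of `τ` over `K[C \ C̃]` will do; uniqueness is available only after
  -- passing to the quotient.
  choose N hNred hNsteps using fun τ : border O => exists_pommaret_reduces hO
    (fun α σ => (X (pommaretParam O hO α σ) : MvPolynomial ↥(Ctilde O)ᶜ K))
    (monomial (τ : Term n) 1)
  have hN : ∀ τ : border O, monomial (τ : Term n) 1 - N τ ∈
      Ideal.span (Set.range (genericPommaretSet K O hO)) := fun τ =>
    ReductionStructure.multSpan_subset_span (hNsteps τ).sub_mem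
  have hNq : ∀ {A : Type _} [CommRing A] (f : MvPolynomial ↥(Ctilde O)ᶜ K →+* A) (τ : border O),
      monomial (τ : Term n) 1 - MvPolynomial.map f (N τ) ∈
        Ideal.span (Set.range (specPommaret hO f)) := by
    intro A _ f τ
    have h1 := map_mem_span_range (hN τ) f
    have h2 : (fun τ => MvPolynomial.map f (genericPommaretSet K O hO τ)) = specPommaret hO f :=
      funext fun τ => map_genericPommaretSet hO f τ
    rwa [h2, map_sub, map_monomial, _root_.map_one] at h1
  let ψ : MvPolynomial (Param O) K →ₐ[K] MvPolynomial ↥(Ctilde O)ᶜ K ⧸ pommaretIdeal K O hO :=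
    aeval fun i => q (coeff (i.2 : Term n) (N i.1))
  have hψ : ∀ i, ψ (X i) = q (coeff (i.2 : Term n) (N i.1)) := fun i => aeval_X _ i
  have hspec : ∀ τ, specBorder ψ.toRingHom τ = monomial (τ : Term n) 1 -
      MvPolynomial.map q (N τ) := by
    intro τ
    rw [specBorder, marked, ((hNred τ).map q).eq_ofCoeffs]
    congr 2
    funext σ
    rw [coeff_map]
    exact hψ (τ, σ)
  refine ⟨ψ, borderIdeal_le_ker _ fun h hr hh => eq_zero_of_mem_span_pommaret hr ?_,
    ?_, ?_⟩
  · refine Ideal.span_le.mpr ?_ hh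
    rintro _ ⟨τ, rfl⟩
    rw [hspec]
    exact hNq q τ
  -- For `τ ∈ P_O`, both `τ - N τ` and the marked polynomial of `τ` lie in the Pommaret ideal. Their
  -- difference is `O`-reduced, hence zero.
  · rintro ⟨⟨τ, σ⟩, hi⟩
    have hτ : (τ : Term n) ∈ pommaretBasis O := not_not.mp hi
    have h1 : specPommaret hO q ⟨τ, hτ⟩ ∈ Ideal.span (Set.range (specPommaret hO q)) :=
      Ideal.subset_span ⟨_, rfl⟩
    have h2 := Ideal.sub_mem _ (hNq q τ) h1
    rw [specPommaret, pommaretMarked, marked, sub_sub_sub_cancel_left] at h2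
    have h3 := eq_zero_of_mem_span_pommaret
      ((isReduced_ofCoeffs O _).sub ((hNred τ).map q)) h2
    have h4 := congrArg (coeff (σ : Term n)) h3
    rw [coeff_sub, coeff_ofCoeffs_of_mem, coeff_map, coeff_zero, sub_eq_zero] at h4
    rw [hψ]
    exact h4.symm
  -- The same uniqueness argument over `K[C] / 𝔅`, where the border ideal contains the Pommaret one.
  · rintro ⟨τ, σ⟩
    refine ⟨coeff (σ : Term n) (N τ), hψ _, ?_⟩
    have h1 := span_specPommaret_le β h0
      (hNq (toBorderQuotient (K := K) (hO := hO) β).toRingHom τ)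
    have h2 : specBorder (Ideal.Quotient.mk (borderIdeal K O hO β)) τ ∈ Ideal.span
        (Set.range (specBorder (Ideal.Quotient.mk (borderIdeal K O hO β)))) :=
      Ideal.subset_span ⟨_, rfl⟩
    have h3 := Ideal.sub_mem _ h1 h2
    rw [specBorder, marked, sub_sub_sub_cancel_left] at h3
    have h4 := congrArg (coeff (σ : Term n)) (eq_zero_of_mem_span_border hO β hβ h0
      ((isReduced_ofCoeffs O _).sub ((hNred τ).map _)) h3)
    rw [coeff_sub, coeff_ofCoeffs_of_mem, coeff_map, coeff_zero, sub_eq_zero] at h4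
    exact h4.symm

variable (K) in
/-- The coordinate rings of the two marked schemes are isomorphic, compatibly with the inclusion
of the polynomial rings. -/
theorem exists_ringEquiv (hO : IsLowerSet (O : Set (Term n)))
    (β : Fin (border O).card ≃ border O) (hβ : Monotone fun i => (β i : Term n).degree) :
    ∃ e : (MvPolynomial ↥(Ctilde O)ᶜ K ⧸ pommaretIdeal K O hO) ≃+*
        (MvPolynomial (Param O) K ⧸ borderIdeal K O hO β),
      ∀ p, e (Ideal.Quotient.mk _ p) =
        Ideal.Quotient.mk _ (rename (Subtype.val : ↥(Ctilde O)ᶜ → Param O) p) := by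
  have key : pommaretIdeal K O hO ≤ RingHom.ker (toBorderQuotient (hO := hO) β).toRingHom ∧
      ∃ ψ : MvPolynomial (Param O) K →ₐ[K] MvPolynomial ↥(Ctilde O)ᶜ K ⧸ pommaretIdeal K O hO,
        borderIdeal K O hO β ≤ RingHom.ker ψ.toRingHom ∧
        (∀ i : ↥(Ctilde O)ᶜ, ψ (X i.1) = Ideal.Quotient.mk (pommaretIdeal K O hO) (X i)) ∧
        ∀ i : Param O, ∃ p, ψ (X i) = Ideal.Quotient.mk (pommaretIdeal K O hO) p ∧
          toBorderQuotient β p = Ideal.Quotient.mk (borderIdeal K O hO β) (X i) := by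
    -- For empty `O` there are no parameters and every `O`-reduced polynomial is zero. This case is
    -- separate because then `P_O = {1}` is not contained in the border.
    rcases O.eq_empty_or_nonempty with rfl | ⟨σ, hσ⟩
    · have hz : ∀ {B : Type _} [CommRing B] (h : MvPolynomial (Fin n) B),
          IsReduced (∅ : Finset (Term n)) h → h = 0 := fun h hr => by
        ext γ
        exact isReduced_iff.mp hr γ (Finset.notMem_empty γ)
      refine ⟨pommaretIdeal_le_ker _ fun h hr _ => hz h hr,
        aeval fun i => (Finset.notMem_empty _ i.2.2).elim,
        borderIdeal_le_ker _ fun h hr _ => hz h hr,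
        fun i => (Finset.notMem_empty _ i.1.2.2).elim,
        fun i => (Finset.notMem_empty _ i.2.2).elim⟩
    · exact exists_algHom_of_nonempty hO β hβ (hO zero_le hσ)
  obtain ⟨h1, ψ, h2, h3, h4⟩ := key
  let φ' : (MvPolynomial ↥(Ctilde O)ᶜ K ⧸ pommaretIdeal K O hO) →ₐ[K]
      (MvPolynomial (Param O) K ⧸ borderIdeal K O hO β) :=
    Ideal.Quotient.liftₐ _ (toBorderQuotient β) fun a ha => h1 ha
  let ψ' : (MvPolynomial (Param O) K ⧸ borderIdeal K O hO β) →ₐ[K]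
      (MvPolynomial ↥(Ctilde O)ᶜ K ⧸ pommaretIdeal K O hO) :=
    Ideal.Quotient.liftₐ _ ψ fun a ha => h2 ha
  have hφ' : ∀ p, φ' (Ideal.Quotient.mk _ p) = toBorderQuotient β p := fun p => rfl
  have hψ' : ∀ p, ψ' (Ideal.Quotient.mk _ p) = ψ p := fun p => rfl
  refine ⟨(AlgEquiv.ofAlgHom φ' ψ' ?_ ?_).toRingEquiv, fun p => rfl⟩
  · refine Ideal.Quotient.algHom_ext _ (MvPolynomial.algHom_ext fun i => ?_)
    obtain ⟨p, hp, hp'⟩ := h4 i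
    change φ' (ψ (X i)) = Ideal.Quotient.mk _ (X i)
    rw [hp, hφ', hp']
  · refine Ideal.Quotient.algHom_ext _ (MvPolynomial.algHom_ext fun i => ?_)
    change ψ' (toBorderQuotient β (X i)) = Ideal.Quotient.mk _ (X i)
    rw [toBorderQuotient_X, hψ', h3]

end BorderPommaret

end

theorem corollary4p3 {K : Type*} [Field K] {n : ℕ}
    (O : Finset (Term n)) (hO : IsLowerSet (O : Set (Term n)))
    (β : Fin (border O).card ≃ border O)
    (hβ : Monotone fun i => (β i : Term n).degree) :
    (∃ e : borderMarkedScheme K O hO β ≅ pommaretMarkedScheme K O hO,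
      e.hom ≫ pommaretEmbedding K O hO = borderEmbedding K O hO β ≫ coordProjection K O) ∧
    IsClosedImmersion (borderEmbedding K O hO β ≫ coordProjection K O) ∧
    Nat.card ↥(Ctilde O)ᶜ + Nat.card ↥(Ctilde O) = Nat.card (Param O) := by
  obtain ⟨e, he⟩ := exists_ringEquiv K hO β hβ
  have hcomp : Spec.map (CommRingCat.ofHom e.toRingHom) ≫ pommaretEmbedding K O hO =
      borderEmbedding K O hO β ≫ coordProjection K O := by
    rw [← Spec.map_comp, ← Spec.map_comp, ← CommRingCat.ofHom_comp, ← CommRingCat.ofHom_comp]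
    congr 2
    exact RingHom.ext he
  refine ⟨⟨Scheme.Spec.mapIso (RingEquiv.toCommRingCatIso e).op, hcomp⟩, ?_, ?_⟩
  -- Through the isomorphism, the composite is `Spec` of a quotient map followed by a ring
  -- isomorphism, which is surjective.
  · rw [← hcomp, ← Spec.map_comp]
    refine IsClosedImmersion.spec_of_surjective _ ?_
    exact e.surjective.comp Ideal.Quotient.mk_surjective
  · rw [add_comm]
    exact Set.ncard_add_ncard_compl (Ctilde O)
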